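/- Let $S_{2n}$ be the star graph with $2n$ leaves and one non-leaf vertex, the core. Initially each leaf carries one particle, $n$ of them blue and the other $n$ red. At each step, with probability $p$ a uniformly chosen blue particle, and with probability $1-p$ a uniformly chosen red particle, takes one step of simple random walk on $S_{2n}$ (from a leaf it moves to the core, from the core it moves to a uniformly chosen leaf). If the vertex it moves to carries a particle of the other color, the moving particle and one such particle annihilate each other; particles of the same color do not interact. Let $T^2_p(S_{2n})$ be the number of steps until every particle has been annihilated. (i) For every $c<4$ there is $p_*\in[\tfrac12,1)$, depending only on $c$, such that for every fixed $p\in(p_*,1)$, $E\,T^2_p(S_{2n})<\infty$ for all $n$ and $$E\,T^2_p(S_{2n}) - c\,\log\Big(\frac1{1-p}\Big)\,n = \Omega(1),\quad\text{i.e.}\quad \liminf_{n\to\infty}\Big(E\,T^2_p(S_{2n}) - c\,\log\Big(\frac1{1-p}\Big)\,n\Big) > 0 .$$ (ii) For every $C>12$ there is $p^*\in[\tfrac12,1)$, depending only on $C$, such that for every fixed $p\in(p^*,1)$, $E\,T^2_p(S_{2n})<\infty$ for all $n$ and $$E\,T^2_p(S_{2n}) - C\,\log\Big(\frac1{1-p}\Big)\,n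 = O(1),\quad\text{i.e.}\quad \limsup_{n\to\infty}\Big(E\,T^2_p(S_{2n}) - C\,\log\Big(\frac1{1-p}\Big)\,n\Big) < \infty .$$ Both hold for every choice of the $n$ leaves that initially carry the blue particles. -/

import Mathlib

open MeasureTheory ProbabilityTheory Filter

noncomputable section

namespace TwoType

/-- A configuration of the two-type system on the vertex set `V`: the multiset of the positions of
the blue particles and the multiset of the positions of the red particles that are still alive. -/
@[ext]
structure Config (V : Type) where
  blue : Multiset V
  red : Multiset V

/-- The configuration space is discrete. -/
instance Config.instMeasurableSpace (V : Type) : MeasurableSpace (Config V) := ⊤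

section Dynamics

variable {V : Type} [DecidableEq V]

/-- A blue particle jumps from `v` to `w`. If there is a red particle at `w`, then the jumping
particle and one red particle at `w` annihilate each other. -/
def Config.moveBlue (x : Config V) (v w : V) : Config V :=
  if w ∈ x.red then ⟨x.blue.erase v, x.red.erase w⟩ else ⟨w ::ₘ x.blue.erase v, x.red⟩

/-- A red particle jumps from `v` to `w`. If there is a blue particle at `w`, then the jumping
particle and one blue particle at `w` annihilate each other. -/
def Config.moveRed (x : Config V) (v w : V) : Config V :=
  if w ∈ x.blue then ⟨x.blue.erase w, x.red.erase v⟩ else ⟨x.blue, w ::ₘ x.red.erase v⟩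

/-- One step of simple random walk on `G` from `v`: a uniformly chosen neighbor of `v`
(the walk stays put at an isolated vertex). -/
def walkStep [Fintype V] (G : SimpleGraph V) [DecidableRel G.Adj] (v : V) : PMF V :=
  if h : (G.neighborFinset v).Nonempty then PMF.uniformOfFinset (G.neighborFinset v) h
  else PMF.pure v

/-- The law of the color of the sampled particle: blue (`true`) with probability `p`, and red
(`false`) with probability `1 - p`. -/
def colorLaw (p : unitInterval) : PMF Bool :=
  PMF.ofFintype (fun isBlue => if isBlue then ENNReal.ofReal p else ENNReal.ofReal (1 - p)) (by
    simp [← ENNReal.ofReal_add p.2.1 (sub_nonneg.2 p.2.2)])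

/-- One step of the two-type system on `G`: with probability `p` a uniformly chosen blue particle,
and otherwise a uniformly chosen red particle, takes one step of simple random walk. Particles
disappear in pairs of opposite colors, so that a system started with equally many particles of each
color either has particles of both colors or is empty; the empty configuration is absorbing. -/
def step [Fintype V] (G : SimpleGraph V) [DecidableRel G.Adj] (p : unitInterval) (x : Config V) :
    PMF (Config V) :=
  if h : x.blue ≠ 0 ∧ x.red ≠ 0 then
    (colorLaw p).bind fun isBlue =>
      if isBlue then
        (PMF.ofMultiset x.blue h.1).bind fun v => (walkStep G v).map fun w => x.moveBlue v w
      else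
        (PMF.ofMultiset x.red h.2).bind fun v => (walkStep G v).map fun w => x.moveRed v w
  else PMF.pure x

/-- The transition kernel of the two-type system on `G`. -/
def stepKernel [Fintype V] (G : SimpleGraph V) [DecidableRel G.Adj] (p : unitInterval) :
    Kernel (Config V) (Config V) where
  toFun x := (step G p x).toMeasure
  measurable' := measurable_from_top

instance [Fintype V] (G : SimpleGraph V) [DecidableRel G.Adj] (p : unitInterval) :
    IsMarkovKernel (stepKernel G p) :=
  ⟨fun x => PMF.toMeasure.isProbabilityMeasure (step G p x)⟩

/-- The law of the trajectory of the two-type system on `G` started from `x₀`: the law of the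
time-homogeneous Markov chain with transition kernel `stepKernel G p`. -/
def law [Fintype V] (G : SimpleGraph V) [DecidableRel G.Adj] (p : unitInterval) (x₀ : Config V) :
    Measure (ℕ → Config V) :=
  Kernel.trajMeasure (X := fun _ => Config V) (Measure.dirac x₀)
    (fun n => (stepKernel G p).comap (fun h : (Π _ : Finset.Iic n, Config V) =>
      h ⟨n, Finset.mem_Iic.2 le_rfl⟩) (measurable_pi_apply _))

/-- The number of steps until every particle is annihilated (`⊤` if this never happens). -/
def extinctionTime (ω : ℕ → Config V) : ℕ∞ :=
  ⨅ (t : ℕ) (_ : (ω t).blue = 0 ∧ (ω t).red = 0), (t : ℕ∞)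

/-- The expected number of steps until every particle is annihilated, for the two-type system on
`G` started from `x₀`. -/
def expectedTime [Fintype V] (G : SimpleGraph V) [DecidableRel G.Adj] (p : unitInterval)
    (x₀ : Config V) : ENNReal :=
  ∫⁻ ω, (extinctionTime ω : ENNReal) ∂(law G p x₀)

end Dynamics

/-- The star graph with `m` leaves: its core is `Sum.inl ()` and its leaves are `Sum.inr i`. -/
abbrev starGraph (m : ℕ) : SimpleGraph (Unit ⊕ Fin m) := completeBipartiteGraph Unit (Fin m)

instance (m : ℕ) : DecidableRel (starGraph m).Adj := fun v w =>
  inferInstanceAs (Decidable (v.isLeft ∧ w.isRight ∨ v.isRight ∧ w.isLeft))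

/-- One particle at each leaf of the star graph: blue at the leaves in `B`, red at the others. -/
def starInit {m : ℕ} (B : Finset (Fin m)) : Config (Unit ⊕ Fin m) where
  blue := B.val.map Sum.inr
  red := Bᶜ.val.map Sum.inr

/-- `E T_p^2(S_{2n})`, where the leaves in `B` are those that initially carry a blue particle. -/
def starTime (p : unitInterval) (n : ℕ) (B : Finset (Fin (2 * n))) : ENNReal :=
  expectedTime (starGraph (2 * n)) p (starInit B)

end TwoType

end

/-!
The expected extinction time is squeezed between two Lyapunov functions of the chain. Write `q` for
`1 - p`, `k` for the number of remaining pairs, `b` for the number of blue particles in the core.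
Vertices never carry both colors, so red particles enter the core only while `b = 0`.

While `b > 0`, a pair is annihilated in one step with probability about `p * b / (2 * n) + q`: a blue
particle jumps from the core onto one of at most `k` red leaves, or any red particle jumps into the
core. Since `b` relaxes to `k / 2`, the average waiting time is `4 * n * wait k` with
`wait k = 1 / (p * k + 4 * n * q)`, and the sum over `k ≤ n` is `4 * n * log (1 / q) + O(n)`. The
correction `-b * (k * wait k)` solves the Poisson equation for the fluctuation of `b`, so that
`4 * n * ∑ wait - b * (k * wait k)` has drift exactly `-1` as long as the red particles sit on
different leaves (`lower_drift_identity`, `upper_drift_identity`).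

* For the lower bound, several red particles on one leaf only slow the system down, and those in the
  core may be treated as already annihilated, since the next blue jump removes one of them. The
  corrected sum, evaluated at the pairs without red particle in the core, therefore has drift at
  least `-1` (`lowerFn_le_starMean`).
* For the upper bound, the loss caused by red particles sharing a leaf is proportional to their
  excess `D`, and is paid by a term `(2 * p / q) * (∑ wait) * D`. The excess grows only by red jumps
  made while red particles occupy the core; a blue jump then annihilates with certainty, so a bonus
  of order `log (1 / q)` per annihilation pays for the growth. A harmonic sum pays for the times
  with `b = 0`. The drift is at most `-1` (`starMean_upperFn_le`), and the total is at most
  `(12 * log (1 / q) + 8) * n + O(log n)` (`upperProfile_start_le`).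

The drift bounds are turned into bounds on the expectation by `expectedTime_le_of_drift` and
`le_expectedTime_of_drift`. The constant `4` or `12` is missed by a multiple of `n` that does not
depend on `p`, and is absorbed by the gap to `c` or `C` once `log (1 / q)` is large.
-/

namespace TwoType

/-! ### Trajectories and the Foster–Lyapunov bounds -/

/-- The integral of a function against a probability mass function on a discrete space. -/
lemma lintegral_pmf_toMeasure {α : Type*} [MeasurableSpace α] [DiscreteMeasurableSpace α]
    (P : PMF α) (f : α → ENNReal) : ∫⁻ a, f a ∂P.toMeasure = ∑' a, P a * f a := by
  calc
    _ = ∫⁻ a in P.support, f a ∂P.toMeasure := by rw [PMF.restrict_toMeasure_support P]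
    _ = ∑' a : P.support, f a * P.toMeasure {(a : α)} :=
      lintegral_countable f P.support_countable
    _ = ∑' a : P.support, P a * f a := by
      congr with a
      rw [PMF.toMeasure_apply_singleton P a (MeasurableSet.singleton _), mul_comm]
    _ = ∑' a, P a * f a :=
      tsum_subtype_eq_of_support_subset (f := fun a => P a * f a) fun x hx =>
        (PMF.mem_support_iff P x).2 fun hP => hx (by simp [hP])

instance Config.instDiscreteMeasurableSpace (V : Type) : DiscreteMeasurableSpace (Config V) :=
  ⟨fun _ => MeasurableSpace.measurableSet_top⟩

variable {V : Type}

/-- A configuration is alive if at least one particle is left. -/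
def Config.Alive (x : Config V) : Prop := ¬(x.blue = 0 ∧ x.red = 0)

/-- The indicator function of the alive configurations. -/
noncomputable def aliveInd (x : Config V) : ENNReal := Set.indicator {x | x.Alive} 1 x

lemma aliveInd_of_alive {x : Config V} (h : x.Alive) : aliveInd x = 1 :=
  Set.indicator_of_mem (s := {x : Config V | x.Alive}) h 1

lemma aliveInd_of_not_alive {x : Config V} (h : ¬ x.Alive) : aliveInd x = 0 :=
  Set.indicator_of_notMem (s := {x : Config V | x.Alive}) h 1

lemma measurable_comp_eval (f : Config V → ENNReal) (t : ℕ) :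
    Measurable fun ω : ℕ → Config V => f (ω t) :=
  Measurable.comp measurable_from_top (measurable_pi_apply t)

lemma extinctionTime_le_tsum (ω : ℕ → Config V) :
    (extinctionTime ω : ENNReal) ≤ ∑' t, aliveInd (ω t) := by
  have key : ∀ N : ℕ, (∀ t < N, (ω t).Alive) → (N : ENNReal) ≤ ∑' t, aliveInd (ω t) := by
    intro N hN
    calc (N : ENNReal) = ∑ t ∈ Finset.range N, aliveInd (ω t) := by
          rw [Finset.sum_congr rfl fun t ht => aliveInd_of_alive (hN t (Finset.mem_range.1 ht))]
          simp
      _ ≤ _ := ENNReal.sum_le_tsum _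
  by_cases h : ∃ t, ¬ (ω t).Alive
  · classical
    have hle : extinctionTime ω ≤ (Nat.find h : ℕ∞) :=
      iInf₂_le (Nat.find h) (by simpa only [Config.Alive, not_not] using Nat.find_spec h)
    calc (extinctionTime ω : ENNReal) ≤ ((Nat.find h : ℕ∞) : ENNReal) := by exact_mod_cast hle
      _ = (Nat.find h : ENNReal) := by simp
      _ ≤ _ := key _ fun t ht => not_not.1 (Nat.find_min h ht)
  · push Not at h
    have : ∑' t, aliveInd (ω t) = ⊤ := by
      refine ENNReal.eq_top_of_forall_nnreal_le fun r => ?_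
      obtain ⟨N, hN⟩ := exists_nat_ge r
      exact le_trans (by exact_mod_cast hN) (key N fun t _ => h t)
    simp [this]

lemma tsum_le_extinctionTime {ω : ℕ → Config V}
    (hω : ∀ s t, s ≤ t → ¬ (ω s).Alive → ¬ (ω t).Alive) :
    ∑' t, aliveInd (ω t) ≤ (extinctionTime ω : ENNReal) := by
  by_cases h : ∃ t, ¬ (ω t).Alive
  · classical
    have hle : (Nat.find h : ℕ∞) ≤ extinctionTime ω :=
      le_iInf₂ fun t ht => by exact_mod_cast Nat.find_min' h (not_not.2 ht)
    calc ∑' t, aliveInd (ω t) = ∑ t ∈ Finset.range (Nat.find h), aliveInd (ω t) := by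
          refine tsum_eq_sum fun t ht => aliveInd_of_not_alive ?_
          exact hω _ t (not_lt.1 fun hlt => ht (Finset.mem_range.2 hlt)) (Nat.find_spec h)
      _ = (Nat.find h : ENNReal) := by
          rw [Finset.sum_congr rfl fun t ht => aliveInd_of_alive
            (not_not.1 (Nat.find_min h (Finset.mem_range.1 ht)))]
          simp
      _ = ((Nat.find h : ℕ∞) : ENNReal) := by simp
      _ ≤ _ := by exact_mod_cast hle
  · have htop : extinctionTime ω = ⊤ := by
      push Not at h
      refine iInf₂_eq_top.2 fun t ht => absurd ht (h t)
    simp [htop]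

section Law

variable [DecidableEq V] [Fintype V] (G : SimpleGraph V) [DecidableRel G.Adj]
  (p : unitInterval)

instance (x₀ : Config V) : IsProbabilityMeasure (law G p x₀) := by
  unfold law; infer_instance

variable {G p}


lemma lintegral_law_zero (x₀ : Config V) (f : Config V → ENNReal) :
    ∫⁻ ω, f (ω 0) ∂(law G p x₀) = f x₀ := by
  have hmap : (law G p x₀).map (fun ω => ω 0) = Measure.dirac x₀ := by
    unfold law Kernel.trajMeasure
    have h0 : (fun ω : ℕ → Config V => ω 0) =
        (fun h : (Π _ : Finset.Iic 0, Config V) => h ⟨0, Finset.mem_Iic.2 le_rfl⟩) ∘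
          (Preorder.frestrictLe (π := fun _ : ℕ => Config V) 0) := by
      ext1 ω; rfl
    rw [h0, ← Measure.map_map (measurable_pi_apply _) (by fun_prop),
      Measure.map_comp _ _ (by fun_prop), Kernel.traj_map_frestrictLe,
      Kernel.partialTraj_self, Measure.id_comp, Measure.map_map (measurable_pi_apply _) (by fun_prop),
      Measure.map_dirac' ((measurable_pi_apply _).comp (MeasurableEquiv.measurable _))]
    rfl
  rw [← lintegral_map (f := f) measurable_from_top (measurable_pi_apply 0), hmap,
    lintegral_dirac]

/-- The Markov property: given the present, the next configuration has law `step`. -/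
lemma lintegral_law_succ (x₀ : Config V) (t : ℕ) {h : Config V × Config V → ENNReal}
    (hh : Measurable h) :
    ∫⁻ ω, h (ω t, ω (t + 1)) ∂(law G p x₀) =
      ∫⁻ ω, ∑' y, step G p (ω t) y * h (ω t, y) ∂(law G p x₀) := by
  let κ : (n : ℕ) → Kernel (Π _ : Finset.Iic n, Config V) (Config V) := fun n =>
    (stepKernel G p).comap (fun h : (Π _ : Finset.Iic n, Config V) =>
      h ⟨n, Finset.mem_Iic.2 le_rfl⟩) (measurable_pi_apply _)
  have key := Kernel.map_frestrictLe_trajMeasure_compProd_eq_map_trajMeasure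
    (X := fun _ => Config V) (μ₀ := Measure.dirac x₀) (κ := κ) (a := t)
  let e : (Π _ : Finset.Iic t, Config V) → Config V := fun z => z ⟨t, Finset.mem_Iic.2 le_rfl⟩
  have he : Measurable e := measurable_pi_apply _
  let H : (Π _ : Finset.Iic t, Config V) × Config V → ENNReal := fun z => h (e z.1, z.2)
  have hH : Measurable H := hh.comp ((he.comp measurable_fst).prodMk measurable_snd)
  have h1 : ∫⁻ ω, h (ω t, ω (t + 1)) ∂(law G p x₀) =
      ∫⁻ z, H z ∂((law G p x₀).map
        (fun ω => (Preorder.frestrictLe (π := fun _ : ℕ => Config V) t ω, ω (t + 1)))) := by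
    rw [lintegral_map hH (by fun_prop)]
    rfl
  have h2 : (law G p x₀).map
        (fun ω => (Preorder.frestrictLe (π := fun _ : ℕ => Config V) t ω, ω (t + 1))) =
      (law G p x₀).map (Preorder.frestrictLe (π := fun _ : ℕ => Config V) t) ⊗ₘ κ t := key.symm
  rw [h1, h2, Measure.lintegral_compProd hH, lintegral_map (hH.lintegral_kernel_prod_right')
    (by fun_prop)]
  refine lintegral_congr fun ω => ?_
  exact lintegral_pmf_toMeasure (step G p (ω t)) fun y => h (ω t, y)

lemma step_of_not_alive {x : Config V} (h : ¬ x.Alive) : step G p x = PMF.pure x := by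
  have h' := not_not.1 h
  rw [step, dif_neg (by simp [h'.1])]

/-- Almost surely, an extinct system stays extinct. -/
lemma ae_not_alive_of_le (x₀ : Config V) :
    ∀ᵐ ω ∂(law G p x₀), ∀ s t, s ≤ t → ¬ (ω s).Alive → ¬ (ω t).Alive := by
  have hone : ∀ t, ∀ᵐ ω ∂(law G p x₀), ¬ (ω t).Alive → ¬ (ω (t + 1)).Alive := by
    intro t
    let h : Config V × Config V → ENNReal := fun z =>
      Set.indicator {x : Config V | ¬ x.Alive} 1 z.1 * aliveInd z.2
    have hh : Measurable h := by
      refine Measurable.mul ?_ ?_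
      · exact Measurable.comp (g := Set.indicator {x : Config V | ¬ x.Alive} (1 : Config V → ENNReal))
          measurable_from_top measurable_fst
      · exact Measurable.comp (g := aliveInd) measurable_from_top measurable_snd
    have h0 : ∫⁻ ω, h (ω t, ω (t + 1)) ∂(law G p x₀) = 0 := by
      rw [lintegral_law_succ x₀ t hh]
      refine (lintegral_congr fun ω => ?_).trans lintegral_zero
      refine ENNReal.tsum_eq_zero.2 fun y => ?_
      by_cases hω : (ω t).Alive
      · have : h (ω t, y) = 0 := by simp [h, hω]
        simp [this]
      · rw [step_of_not_alive hω, PMF.pure_apply]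
        split_ifs with hy
        · have : h (ω t, y) = 0 := by
            simp [h, hy, aliveInd_of_not_alive hω]
          simp [this]
        · simp
    have h1 := (lintegral_eq_zero_iff (hh.comp (f := fun ω : ℕ → Config V => (ω t, ω (t + 1)))
      ((measurable_pi_apply t).prodMk (measurable_pi_apply (t + 1))))).1 h0
    filter_upwards [h1] with ω hω hs hal
    simp [h, hs, aliveInd_of_alive hal] at hω
  filter_upwards [ae_all_iff.2 hone] with ω hω s t hst hs
  induction t, hst using Nat.le_induction with
  | base => exact hs
  | succ t _ ih => exact hω t ih

/-- The expected extinction time is the sum of the survival probabilities. -/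
lemma expectedTime_eq_tsum (x₀ : Config V) :
    expectedTime G p x₀ = ∑' t, ∫⁻ ω, aliveInd (ω t) ∂(law G p x₀) := by
  rw [← lintegral_tsum fun t =>
    (measurable_comp_eval aliveInd t).aemeasurable]
  refine lintegral_congr_ae ?_
  filter_upwards [ae_not_alive_of_le x₀] with ω hω
  exact le_antisymm (extinctionTime_le_tsum ω) (tsum_le_extinctionTime hω)

/-- A nonnegative function that decreases on average by at least one in every step from an alive
configuration bounds the expected extinction time from above. -/
theorem expectedTime_le_of_drift {f : Config V → ENNReal}
    (hf : ∀ x, ∑' y, step G p x y * f y + aliveInd x ≤ f x) (x₀ : Config V) :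
    expectedTime G p x₀ ≤ f x₀ := by
  have key : ∀ t, ∫⁻ ω, f (ω t) ∂(law G p x₀) +
      ∑ s ∈ Finset.range t, ∫⁻ ω, aliveInd (ω s) ∂(law G p x₀) ≤ f x₀ := by
    intro t
    induction t with
    | zero => simp [lintegral_law_zero]
    | succ t ih =>
      refine le_trans ?_ ih
      rw [Finset.sum_range_succ, add_comm (∑ s ∈ Finset.range t, _), ← add_assoc]
      gcongr
      rw [lintegral_law_succ x₀ t (h := fun z => f z.2)
          (Measurable.comp (g := f) measurable_from_top measurable_snd),
        ← lintegral_add_right _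
          (measurable_comp_eval aliveInd t)]
      exact lintegral_mono fun ω => hf (ω t)
  rw [expectedTime_eq_tsum, ENNReal.tsum_eq_iSup_nat]
  exact iSup_le fun t => le_trans le_add_self (key t)

/-- A bounded function that vanishes at extinction and decreases on average by at most one in every
step bounds the expected extinction time from below. -/
theorem le_expectedTime_of_drift {f : Config V → ENNReal} {M : NNReal}
    (hM : ∀ x, f x ≤ M * aliveInd x)
    (hf : ∀ x, f x ≤ ∑' y, step G p x y * f y + aliveInd x) (x₀ : Config V) :
    f x₀ ≤ expectedTime G p x₀ := by
  have key : ∀ t, f x₀ ≤ ∫⁻ ω, f (ω t) ∂(law G p x₀) +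
      ∑ s ∈ Finset.range t, ∫⁻ ω, aliveInd (ω s) ∂(law G p x₀) := by
    intro t
    induction t with
    | zero => simp [lintegral_law_zero]
    | succ t ih =>
      refine ih.trans ?_
      rw [Finset.sum_range_succ, add_comm (∑ s ∈ Finset.range t, _), ← add_assoc]
      gcongr
      rw [lintegral_law_succ x₀ t (h := fun z => f z.2)
          (Measurable.comp (g := f) measurable_from_top measurable_snd),
        ← lintegral_add_right _
          (measurable_comp_eval aliveInd t)]
      exact lintegral_mono fun ω => hf (ω t)
  by_cases htop : expectedTime G p x₀ = ⊤
  · simp [htop]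
  rw [expectedTime_eq_tsum] at htop ⊢
  have hlim : Tendsto (fun t => M * ∫⁻ ω, aliveInd (ω t) ∂(law G p x₀) +
      ∑' s, ∫⁻ ω, aliveInd (ω s) ∂(law G p x₀)) atTop
      (nhds (M * 0 + ∑' s, ∫⁻ ω, aliveInd (ω s) ∂(law G p x₀))) :=
    (ENNReal.Tendsto.const_mul (ENNReal.tendsto_atTop_zero_of_tsum_ne_top htop)
      (Or.inr ENNReal.coe_ne_top)).add tendsto_const_nhds
  rw [mul_zero, zero_add] at hlim
  refine ge_of_tendsto' hlim fun t => (key t).trans ?_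
  gcongr
  · rw [← lintegral_const_mul _
      (measurable_comp_eval aliveInd t)]
    exact lintegral_mono fun ω => hM (ω t)
  · exact ENNReal.sum_le_tsum _

end Law

/-! ### One step on the star graph -/

lemma tsum_bind_mul {α β : Type*} (P : PMF α) (g : α → PMF β) (f : β → ENNReal) :
    ∑' b, (P.bind g) b * f b = ∑' a, P a * ∑' b, g a b * f b := by
  simp_rw [PMF.bind_apply, ← ENNReal.tsum_mul_right, ← ENNReal.tsum_mul_left]
  rw [ENNReal.tsum_comm]
  simp_rw [mul_assoc]

lemma tsum_map_mul {α β : Type*} (P : PMF α) (g : α → β) (f : β → ENNReal) :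
    ∑' b, (P.map g) b * f b = ∑' a, P a * f (g a) := by
  rw [PMF.map, tsum_bind_mul]
  refine tsum_congr fun a => ?_
  congr 1
  rw [tsum_eq_single (g a)]
  · simp
  · intro b hb
    simp [hb]

lemma tsum_ofMultiset_mul {α : Type*} [DecidableEq α] [Fintype α] {s : Multiset α} (hs : s ≠ 0)
    {f : α → ℝ} (hf : ∀ a, 0 ≤ f a) :
    ∑' a, PMF.ofMultiset s hs a * ENNReal.ofReal (f a) =
      ENNReal.ofReal ((s.map f).sum / Multiset.card s) := by
  have hc : (0 : ℝ) < Multiset.card s := by exact_mod_cast Multiset.card_pos.2 hs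
  rw [tsum_fintype, Finset.sum_multiset_map_count, Finset.sum_div,
    ENNReal.ofReal_sum_of_nonneg fun a _ => by have := hf a; positivity,
    ← Finset.sum_subset (Finset.subset_univ s.toFinset)]
  · refine Finset.sum_congr rfl fun a _ => ?_
    rw [PMF.ofMultiset_apply, nsmul_eq_mul, mul_div_right_comm,
      ENNReal.ofReal_mul (by positivity), ENNReal.ofReal_div_of_pos hc,
      ENNReal.ofReal_natCast, ENNReal.ofReal_natCast]
    congr!
  · intro a _ ha
    rw [PMF.ofMultiset_apply_of_notMem _ (by simpa using ha), zero_mul]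

/-- The mean of `g` over the neighbors of the vertex `v` of the star graph with `m` leaves. -/
noncomputable def nbrMean (m : ℕ) (g : Unit ⊕ Fin m → ℝ) : Unit ⊕ Fin m → ℝ
  | Sum.inl _ => (∑ i, g (Sum.inr i)) / m
  | Sum.inr _ => g (Sum.inl ())

lemma neighborFinset_core (m : ℕ) :
    (starGraph m).neighborFinset (Sum.inl ()) = Finset.univ.map Function.Embedding.inr := by
  ext w
  rw [SimpleGraph.mem_neighborFinset]
  rcases w with w | w <;> simp

lemma neighborFinset_leaf {m : ℕ} (i : Fin m) :
    (starGraph m).neighborFinset (Sum.inr i) = {Sum.inl ()} := by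
  ext w
  rw [SimpleGraph.mem_neighborFinset]
  rcases w with w | w <;> simp

lemma tsum_walkStep_mul {m : ℕ} (hm : 0 < m) (v : Unit ⊕ Fin m) {g : Unit ⊕ Fin m → ℝ}
    (hg : ∀ w, 0 ≤ g w) :
    ∑' w, walkStep (starGraph m) v w * ENNReal.ofReal (g w) = ENNReal.ofReal (nbrMean m g v) := by
  have hm' : (0 : ℝ) < m := by exact_mod_cast hm
  rcases v with ⟨⟩ | i
  · have hne : ((starGraph m).neighborFinset (Sum.inl ())).Nonempty := by
      rw [neighborFinset_core]
      exact ⟨Sum.inr ⟨0, hm⟩, by simp⟩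
    rw [walkStep, dif_pos hne, tsum_fintype, Fintype.sum_sum_type]
    have h0 : ∀ u : Unit, PMF.uniformOfFinset _ hne (Sum.inl u) = 0 := fun u =>
      PMF.uniformOfFinset_apply_of_notMem hne (by rw [neighborFinset_core]; simp)
    have h1 : ∀ i : Fin m, PMF.uniformOfFinset _ hne (Sum.inr i) = (m : ENNReal)⁻¹ := fun i => by
      rw [PMF.uniformOfFinset_apply_of_mem hne (by rw [neighborFinset_core]; simp),
        neighborFinset_core]
      simp
    simp only [h0, h1, zero_mul, Finset.sum_const_zero, zero_add, nbrMean]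
    rw [← Finset.mul_sum, ← ENNReal.ofReal_sum_of_nonneg fun i _ => hg _,
      ENNReal.ofReal_div_of_pos hm', mul_comm, ENNReal.ofReal_natCast, div_eq_mul_inv]
  · have hne : ((starGraph m).neighborFinset (Sum.inr i)).Nonempty := by
      rw [neighborFinset_leaf]
      exact ⟨_, Finset.mem_singleton_self _⟩
    rw [walkStep, dif_pos hne, tsum_eq_single (Sum.inl ())]
    · rw [PMF.uniformOfFinset_apply_of_mem hne (by rw [neighborFinset_leaf]; simp),
        neighborFinset_leaf]
      simp [nbrMean]
    · intro w hw
      rw [PMF.uniformOfFinset_apply_of_notMem hne (by rw [neighborFinset_leaf]; simpa using hw),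
        zero_mul]

/-- The mean of `g v w` for a uniformly chosen element `v` of the multiset `s` of vertices of the
star graph and a uniformly chosen neighbor `w` of `v`. -/
noncomputable def jumpMean {m : ℕ} (s : Multiset (Unit ⊕ Fin m))
    (g : Unit ⊕ Fin m → Unit ⊕ Fin m → ℝ) : ℝ :=
  (s.map fun v => nbrMean m (g v) v).sum / Multiset.card s

/-- The mean of `f` after one step of the two-type system on the star graph from an alive
configuration. -/
noncomputable def starMean {m : ℕ} (p : ℝ) (f : Config (Unit ⊕ Fin m) → ℝ)
    (x : Config (Unit ⊕ Fin m)) : ℝ :=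
  p * jumpMean x.blue (fun v w => f (x.moveBlue v w)) +
    (1 - p) * jumpMean x.red (fun v w => f (x.moveRed v w))

lemma nbrMean_nonneg {m : ℕ} {g : Unit ⊕ Fin m → ℝ} (hg : ∀ w, 0 ≤ g w) (v : Unit ⊕ Fin m) :
    0 ≤ nbrMean m g v := by
  rcases v with ⟨⟩ | i
  · exact div_nonneg (Finset.sum_nonneg fun i _ => hg _) (Nat.cast_nonneg _)
  · exact hg _

lemma jumpMean_nonneg {m : ℕ} {s : Multiset (Unit ⊕ Fin m)}
    {g : Unit ⊕ Fin m → Unit ⊕ Fin m → ℝ} (hg : ∀ v w, 0 ≤ g v w) : 0 ≤ jumpMean s g := by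
  refine div_nonneg (Multiset.sum_nonneg fun a ha => ?_) (Nat.cast_nonneg _)
  obtain ⟨v, -, rfl⟩ := Multiset.mem_map.1 ha
  exact nbrMean_nonneg (hg v) v

lemma tsum_jump_mul {m : ℕ} (hm : 0 < m) {s : Multiset (Unit ⊕ Fin m)} (hs : s ≠ 0)
    {f : Config (Unit ⊕ Fin m) → ℝ} (hf : ∀ x, 0 ≤ f x)
    (move : Unit ⊕ Fin m → Unit ⊕ Fin m → Config (Unit ⊕ Fin m)) :
    ∑' y, ((PMF.ofMultiset s hs).bind fun v => (walkStep (starGraph m) v).map fun w => move v w) y *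
      ENNReal.ofReal (f y) = ENNReal.ofReal (jumpMean s fun v w => f (move v w)) := by
  rw [tsum_bind_mul, jumpMean, ← tsum_ofMultiset_mul hs fun v => nbrMean_nonneg (fun w => hf _) v]
  refine tsum_congr fun v => ?_
  rw [tsum_map_mul, tsum_walkStep_mul hm v fun w => hf _]

lemma tsum_step_mul {m : ℕ} (hm : 0 < m) (p : unitInterval) {x : Config (Unit ⊕ Fin m)}
    (hb : x.blue ≠ 0) (hr : x.red ≠ 0) {f : Config (Unit ⊕ Fin m) → ℝ} (hf : ∀ x, 0 ≤ f x) :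
    ∑' y, step (starGraph m) p x y * ENNReal.ofReal (f y) = ENNReal.ofReal (starMean p f x) := by
  rw [step, dif_pos ⟨hb, hr⟩, tsum_bind_mul, tsum_bool, starMean,
    ENNReal.ofReal_add (mul_nonneg p.2.1 (jumpMean_nonneg fun _ _ => hf _))
      (mul_nonneg (sub_nonneg.2 p.2.2) (jumpMean_nonneg fun _ _ => hf _)),
    ENNReal.ofReal_mul p.2.1, ENNReal.ofReal_mul (sub_nonneg.2 p.2.2),
    ← tsum_jump_mul hm hb hf, ← tsum_jump_mul hm hr hf, add_comm]
  simp [colorLaw]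

lemma mem_support_step {V : Type} [DecidableEq V] [Fintype V] {G : SimpleGraph V}
    [DecidableRel G.Adj] {p : unitInterval} {x y : Config V} (hy : step G p x y ≠ 0) :
    y = x ∨ (∃ v ∈ x.blue, ∃ w, y = x.moveBlue v w) ∨ ∃ v ∈ x.red, ∃ w, y = x.moveRed v w := by
  rw [← PMF.mem_support_iff, step] at hy
  split_ifs at hy with h
  · obtain ⟨c, -, hy⟩ := (PMF.mem_support_bind_iff _ _ _).1 hy
    split_ifs at hy
    · obtain ⟨v, hv, hy⟩ := (PMF.mem_support_bind_iff _ _ _).1 hy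
      obtain ⟨w, -, rfl⟩ := (PMF.mem_support_map_iff _ _ _).1 hy
      exact Or.inr (Or.inl ⟨v, by simpa using hv, w, rfl⟩)
    · obtain ⟨v, hv, hy⟩ := (PMF.mem_support_bind_iff _ _ _).1 hy
      obtain ⟨w, -, rfl⟩ := (PMF.mem_support_map_iff _ _ _).1 hy
      exact Or.inr (Or.inr ⟨v, by simpa using hv, w, rfl⟩)
  · exact Or.inl (by simpa using hy)

lemma nbrMean_neg {m : ℕ} (g : Unit ⊕ Fin m → ℝ) (v : Unit ⊕ Fin m) :
    nbrMean m (fun w => -g w) v = -nbrMean m g v := by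
  rcases v with ⟨⟩ | i <;> simp [nbrMean, neg_div]

lemma jumpMean_neg {m : ℕ} (s : Multiset (Unit ⊕ Fin m))
    (g : Unit ⊕ Fin m → Unit ⊕ Fin m → ℝ) :
    jumpMean s (fun v w => -g v w) = -jumpMean s g := by
  simp only [jumpMean, nbrMean_neg, Multiset.sum_map_neg, neg_div]

lemma sum_map_le_count {m : ℕ} {s : Multiset (Unit ⊕ Fin m)} {g : Unit ⊕ Fin m → ℝ} {A B : ℝ}
    (hA : Sum.inl () ∈ s → g (Sum.inl ()) ≤ A) (hB : ∀ i, Sum.inr i ∈ s → g (Sum.inr i) ≤ B) :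
    (s.map g).sum ≤ s.count (Sum.inl ()) * A +
      ((Multiset.card s : ℝ) - s.count (Sum.inl ())) * B := by
  induction s using Multiset.induction with
  | empty => simp
  | cons v s ih =>
    have ih' := ih (fun h => hA (Multiset.mem_cons_of_mem h))
      (fun i h => hB i (Multiset.mem_cons_of_mem h))
    rcases v with ⟨⟩ | i
    · have := hA (Multiset.mem_cons_self _ _)
      simp only [Multiset.map_cons, Multiset.sum_cons, Multiset.count_cons_self, Multiset.card_cons]
      push_cast
      linarith
    · have := hB i (Multiset.mem_cons_self _ _)
      simp only [Multiset.map_cons, Multiset.sum_cons, Multiset.card_cons, Multiset.count_cons]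
      simp
      linarith

/-- A bound on the mean over the jumps of the particles `s` when `t` lies on the leaves: `Z` bounds
the jumps from the core to a leaf occupied by `t`, `X` those to the other leaves, and `Y` those from
a leaf to the core. -/
lemma jumpMean_le_of_core {m : ℕ} (hm : 0 < m) {s t : Multiset (Unit ⊕ Fin m)}
    (ht : Sum.inl () ∉ t) {g : Unit ⊕ Fin m → Unit ⊕ Fin m → ℝ} {X Y Z : ℝ}
    (hZ : ∀ i, Sum.inl () ∈ s → Sum.inr i ∈ t → g (Sum.inl ()) (Sum.inr i) ≤ Z)
    (hX : ∀ i, Sum.inl () ∈ s → Sum.inr i ∉ t → g (Sum.inl ()) (Sum.inr i) ≤ X)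
    (hY : ∀ i, Sum.inr i ∈ s → g (Sum.inr i) (Sum.inl ()) ≤ Y) :
    jumpMean s g ≤ (s.count (Sum.inl ()) * ((t.toFinset.card * Z + (m - t.toFinset.card) * X) / m) +
      ((Multiset.card s : ℝ) - s.count (Sum.inl ())) * Y) / Multiset.card s := by
  have hm' : (0 : ℝ) < m := by exact_mod_cast hm
  unfold jumpMean
  gcongr
  refine sum_map_le_count (fun hs => ?_) fun i hi => hY i hi
  simp only [nbrMean]
  gcongr
  have hcard : (Finset.univ.filter fun i : Fin m => Sum.inr i ∈ t).card = t.toFinset.card := by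
    refine Finset.card_bij (fun i _ => Sum.inr i) ?_ ?_ ?_
    · intro i hi
      simpa using hi
    · intro i _ j _ hij
      exact Sum.inr_injective hij
    · rintro (⟨⟩ | i) hi
      · exact absurd (Multiset.mem_toFinset.1 hi) ht
      · exact ⟨i, by simpa using hi, rfl⟩
  have hcompl : ((Finset.univ.filter fun i : Fin m => ¬ Sum.inr i ∈ t).card : ℝ) =
      m - t.toFinset.card := by
    have := Finset.card_filter_add_card_filter_not (s := (Finset.univ : Finset (Fin m)))
      (fun i : Fin m => Sum.inr i ∈ t)
    rw [hcard, Finset.card_univ, Fintype.card_fin] at this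
    rw [eq_sub_iff_add_eq']
    exact_mod_cast this
  rw [← Finset.sum_filter_add_sum_filter_not Finset.univ (fun i : Fin m => Sum.inr i ∈ t),
    ← hcompl, ← hcard]
  gcongr
  · rw [← nsmul_eq_mul]
    exact Finset.sum_le_card_nsmul _ _ _ fun i hi => hZ i hs (Finset.mem_filter.1 hi).2
  · rw [← nsmul_eq_mul]
    exact Finset.sum_le_card_nsmul _ _ _ fun i hi => hX i hs (Finset.mem_filter.1 hi).2

lemma jumpMean_le {m : ℕ} (hm : 0 < m) {s : Multiset (Unit ⊕ Fin m)} (hs : s ≠ 0)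
    {g : Unit ⊕ Fin m → Unit ⊕ Fin m → ℝ} {W : ℝ}
    (hX : ∀ i, Sum.inl () ∈ s → g (Sum.inl ()) (Sum.inr i) ≤ W)
    (hY : ∀ i, Sum.inr i ∈ s → g (Sum.inr i) (Sum.inl ()) ≤ W) :
    jumpMean s g ≤ W := by
  have hm' : (0 : ℝ) < m := by exact_mod_cast hm
  have hc : (0 : ℝ) < Multiset.card s := by exact_mod_cast Multiset.card_pos.2 hs
  refine (jumpMean_le_of_core hm (t := 0) (by simp) (fun i hs _ => hX i hs)
    (fun i hs _ => hX i hs) hY).trans (le_of_eq ?_)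
  simp
  field_simp
  ring

/-! ### Admissible configurations and the multiplicity excess -/

/-- The configurations that can be reached from one particle on each leaf: equally many blue and
red particles, at most `n` of each, and no vertex carries both colors. -/
structure Admissible {V : Type} (n : ℕ) (x : Config V) : Prop where
  card_eq : Multiset.card x.red = Multiset.card x.blue
  card_le : Multiset.card x.blue ≤ n
  disjoint : ∀ v ∈ x.blue, v ∉ x.red

section Admissible

variable {V : Type} [DecidableEq V] {n : ℕ} {x : Config V}

lemma Admissible.moveBlue (hx : Admissible n x) {v : V} (hv : v ∈ x.blue) (w : V) :
    Admissible n (x.moveBlue v w) := by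
  have hvc := Multiset.card_erase_add_one hv
  have h1 := hx.card_eq
  have h2 := hx.card_le
  unfold Config.moveBlue
  split_ifs with hw
  · have hwc := Multiset.card_erase_add_one hw
    exact ⟨by dsimp only; omega, by dsimp only; omega, fun u hu hu' =>
      hx.disjoint u (Multiset.mem_of_mem_erase hu) (Multiset.mem_of_mem_erase hu')⟩
  · refine ⟨by dsimp only; rw [Multiset.card_cons]; omega,
      by dsimp only; rw [Multiset.card_cons]; omega, fun u hu hu' => ?_⟩
    rcases Multiset.mem_cons.1 hu with rfl | hu
    · exact hw hu'
    · exact hx.disjoint u (Multiset.mem_of_mem_erase hu) hu'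

lemma Admissible.moveRed (hx : Admissible n x) {v : V} (hv : v ∈ x.red) (w : V) :
    Admissible n (x.moveRed v w) := by
  have hvc := Multiset.card_erase_add_one hv
  have h1 := hx.card_eq
  have h2 := hx.card_le
  unfold Config.moveRed
  split_ifs with hw
  · have hwc := Multiset.card_erase_add_one hw
    exact ⟨by dsimp only; omega, by dsimp only; omega, fun u hu hu' =>
      hx.disjoint u (Multiset.mem_of_mem_erase hu) (Multiset.mem_of_mem_erase hu')⟩
  · refine ⟨by dsimp only; rw [Multiset.card_cons]; omega, h2, fun u hu hu' => ?_⟩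
    rcases Multiset.mem_cons.1 hu' with rfl | hu'
    · exact hw hu
    · exact hx.disjoint u hu (Multiset.mem_of_mem_erase hu')

lemma Admissible.step [Fintype V] {G : SimpleGraph V} [DecidableRel G.Adj] {p : unitInterval}
    {y : Config V} (hx : Admissible n x) (hy : step G p x y ≠ 0) : Admissible n y := by
  rcases mem_support_step hy with rfl | ⟨v, hv, w, rfl⟩ | ⟨v, hv, w, rfl⟩
  · exact hx
  · exact hx.moveBlue hv w
  · exact hx.moveRed hv w

omit [DecidableEq V] in
lemma Admissible.ne_zero_of_alive (hx : Admissible n x) (ha : x.Alive) :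
    x.blue ≠ 0 ∧ x.red ≠ 0 := by
  have h1 := hx.card_eq
  unfold Config.Alive at ha
  constructor
  · intro h0
    rw [h0, Multiset.card_zero, Multiset.card_eq_zero] at h1
    exact ha ⟨h0, h1⟩
  · intro h0
    rw [h0, Multiset.card_zero, eq_comm, Multiset.card_eq_zero] at h1
    exact ha ⟨h1, h0⟩

end Admissible

section Excess

variable {α : Type*} [DecidableEq α]

/-- The number of elements of a multiset in excess of the number of its distinct elements. -/
def excess (s : Multiset α) : ℝ := Multiset.card s - s.toFinset.card

lemma excess_nonneg (s : Multiset α) : 0 ≤ excess s :=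
  sub_nonneg.2 (by exact_mod_cast Multiset.toFinset_card_le s)

lemma excess_cons_of_notMem {s : Multiset α} {a : α} (h : a ∉ s) :
    excess (a ::ₘ s) = excess s := by
  simp [excess, h]

lemma excess_cons_le (s : Multiset α) (a : α) : excess (a ::ₘ s) ≤ excess s + 1 := by
  have h : s.toFinset.card ≤ (a ::ₘ s).toFinset.card :=
    Finset.card_le_card fun b hb => by simp_all
  have h' : (s.toFinset.card : ℝ) ≤ (a ::ₘ s).toFinset.card := by exact_mod_cast h
  simp only [excess, Multiset.card_cons]
  push_cast
  linarith

lemma excess_erase_le (s : Multiset α) (a : α) : excess (s.erase a) ≤ excess s := by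
  by_cases ha : a ∈ s
  · have h1 := Multiset.card_erase_add_one ha
    have h2 : s.toFinset.card ≤ (s.erase a).toFinset.card + 1 := by
      refine le_trans (Finset.card_le_card fun b hb => ?_) (Finset.card_insert_le a _)
      by_cases hba : b = a
      · simp [hba]
      · have hb' := Multiset.mem_toFinset.1 hb
        exact Finset.mem_insert_of_mem
          (Multiset.mem_toFinset.2 ((Multiset.mem_erase_of_ne hba).2 hb'))
    have h1' : (Multiset.card (s.erase a) : ℝ) + 1 = Multiset.card s := by exact_mod_cast h1
    have h2' : (s.toFinset.card : ℝ) ≤ (s.erase a).toFinset.card + 1 := by exact_mod_cast h2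
    simp only [excess]
    linarith
  · rw [Multiset.erase_of_notMem ha]

end Excess

/-! ### The scalar profiles -/

/-- The mean number of steps needed per annihilation, divided by `4 * n`, when `k` pairs are left. -/
noncomputable def wait (n : ℕ) (p : ℝ) (k : ℕ) : ℝ := (p * k + 4 * n * (1 - p))⁻¹

/-- The sum of the first `k` values of `wait`. -/
noncomputable def waitSum (n : ℕ) (p : ℝ) (k : ℕ) : ℝ :=
  ∑ j ∈ Finset.range k, wait n p (j + 1)

lemma waitSum_succ (n : ℕ) (p : ℝ) (k : ℕ) :
    waitSum n p (k + 1) = waitSum n p k + wait n p (k + 1) := Finset.sum_range_succ _ _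

section Profile

variable {n : ℕ} {p : ℝ}

lemma wait_denom_pos (hn : 0 < n) (hp0 : 0 < p) (hp1 : p < 1) (k : ℕ) :
    0 < p * k + 4 * n * (1 - p) := by
  have : (0 : ℝ) < n := by exact_mod_cast hn
  have : 0 < 1 - p := by linarith
  positivity

lemma wait_pos (hn : 0 < n) (hp0 : 0 < p) (hp1 : p < 1) (k : ℕ) : 0 < wait n p k :=
  inv_pos.2 (wait_denom_pos hn hp0 hp1 k)

lemma wait_mul (hn : 0 < n) (hp0 : 0 < p) (hp1 : p < 1) (k : ℕ) :
    p * k * wait n p k + 4 * n * (1 - p) * wait n p k = 1 := by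
  rw [← add_mul]
  exact mul_inv_cancel₀ (wait_denom_pos hn hp0 hp1 k).ne'

lemma waitSum_nonneg (hn : 0 < n) (hp0 : 0 < p) (hp1 : p < 1) (k : ℕ) : 0 ≤ waitSum n p k :=
  Finset.sum_nonneg fun _ _ => (wait_pos hn hp0 hp1 _).le

lemma waitSum_mono (hn : 0 < n) (hp0 : 0 < p) (hp1 : p < 1) : Monotone (waitSum n p) :=
  monotone_nat_of_le_succ fun k => by
    rw [waitSum_succ]
    linarith [wait_pos hn hp0 hp1 (k + 1)]

lemma mul_wait_mono (hn : 0 < n) (hp0 : 0 < p) (hp1 : p < 1) (k : ℕ) :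
    k * wait n p k ≤ (k + 1 : ℕ) * wait n p (k + 1) := by
  have hd := wait_denom_pos hn hp0 hp1 k
  have hd' := wait_denom_pos hn hp0 hp1 (k + 1)
  have : 0 ≤ n * (1 - p) := mul_nonneg (Nat.cast_nonneg _) (by linarith)
  rw [wait, wait, ← div_eq_mul_inv, ← div_eq_mul_inv, div_le_div_iff₀ hd hd']
  push_cast at *
  nlinarith

lemma mul_wait_le (hn : 0 < n) (hp0 : 0 < p) (hp1 : p < 1) (k : ℕ) : k * wait n p k ≤ 1 / p := by
  have h := wait_mul hn hp0 hp1 k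
  have h' : 0 ≤ 4 * n * (1 - p) * wait n p k :=
    mul_nonneg (mul_nonneg (by positivity) (by linarith)) (wait_pos hn hp0 hp1 k).le
  rw [le_div_iff₀ hp0]
  linarith

/-- The concave function `k ↦ k * wait k` vanishes at zero, so its last increment is at most its
mean increment. -/
lemma mul_wait_sub_le (hn : 0 < n) (hp0 : 0 < p) (hp1 : p < 1) (k : ℕ) :
    (k + 1) * ((k + 1) * wait n p (k + 1) - k * wait n p k) ≤ 1 / p := by
  have hd := wait_denom_pos hn hp0 hp1 k
  have hd' := wait_denom_pos hn hp0 hp1 (k + 1)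
  have ha : 0 ≤ 4 * n * (1 - p) := mul_nonneg (by positivity) (by linarith)
  set a := 4 * n * (1 - p) with hadef
  push_cast at hd'
  have heq : (k + 1) * ((k + 1) * wait n p (k + 1) - k * wait n p k) =
      (k + 1) * a / ((p * (k + 1) + a) * (p * k + a)) := by
    rw [wait, wait, ← hadef]
    push_cast
    have h0 := mul_inv_cancel₀ hd.ne'
    have h1 := mul_inv_cancel₀ hd'.ne'
    rw [eq_div_iff (mul_pos hd' hd).ne']
    linear_combination ((k : ℝ) + 1) ^ 2 * (p * k + a) * h1 -
      ((k : ℝ) + 1) * k * (p * (k + 1) + a) * h0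
  rw [heq, div_le_div_iff₀ (mul_pos hd' hd) hp0]
  have hk : (0 : ℝ) ≤ k := Nat.cast_nonneg k
  have h1 : 0 ≤ p * p * k * (k + 1) := by positivity
  have h2 : 0 ≤ p * k * a := by positivity
  nlinarith [mul_nonneg ha ha]

end Profile

/-! ### The upper bound -/

/-- The bonus granted for every annihilation. Its part `4 / p` covers the change of the corrections
to the upper Lyapunov function at an annihilation, and the rest the growth of the excess of the red
particles, which a step with red particles in the core increases with probability at most `1 - p`. -/
noncomputable def killBonus (n : ℕ) (p : ℝ) : ℝ := (4 + 2 * p * waitSum n p n) / p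

/-- The upper Lyapunov function of `k` remaining pairs, `b` blue particles in the core and the
excess `D` of the red particles. The coefficient of `D` is chosen so that its increment times
`1 - p` is the loss caused by one unit of excess; the harmonic sum and the last term make up for the
missing drift while the core contains no blue particles. -/
noncomputable def upperProfile (n : ℕ) (p : ℝ) (k b : ℕ) (D : ℝ) : ℝ :=
  4 * n * waitSum n p k - b * (k * wait n p k) + killBonus n p * k +
    2 * p / (1 - p) * waitSum n p k * D + 1 / (1 - p) * ∑ j ∈ Finset.range k, 1 / ((j : ℝ) + 1) +
    (if b = 0 then 1 / p else 0)

/-- The upper Lyapunov function on the configurations on the star graph. -/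
noncomputable def upperFn (n : ℕ) (p : ℝ) {m : ℕ} (x : Config (Unit ⊕ Fin m)) : ℝ :=
  upperProfile n p (Multiset.card x.blue) (x.blue.count (Sum.inl ())) (excess x.red)

section Upper

variable {n : ℕ} {p : ℝ}

lemma mul_killBonus (hp0 : 0 < p) : p * killBonus n p = 4 + 2 * p * waitSum n p n := by
  rw [killBonus]
  field_simp

lemma killBonus_ge (hn : 0 < n) (hp0 : 0 < p) (hp1 : p < 1) : 4 / p ≤ killBonus n p := by
  unfold killBonus
  gcongr
  have := waitSum_nonneg hn hp0 hp1 n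
  nlinarith

lemma upperProfile_nonneg (hn : 0 < n) (hp0 : 0 < p) (hp1 : p < 1) {k b : ℕ} (hb : b ≤ k) {D : ℝ}
    (hD : 0 ≤ D) : 0 ≤ upperProfile n p k b D := by
  have hq : 0 < 1 - p := by linarith
  have hS := waitSum_nonneg hn hp0 hp1 k
  have hb' : (b : ℝ) ≤ k := by exact_mod_cast hb
  have hk : (0 : ℝ) ≤ k := Nat.cast_nonneg k
  have h1 : (b : ℝ) * (k * wait n p k) ≤ k * (1 / p) :=
    mul_le_mul hb' (mul_wait_le hn hp0 hp1 k)
      (mul_nonneg hk (wait_pos hn hp0 hp1 k).le) hk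
  have h2 : (k : ℝ) * (1 / p) ≤ killBonus n p * k := by
    rw [mul_comm]
    gcongr
    refine le_trans ?_ (killBonus_ge hn hp0 hp1)
    gcongr
    norm_num
  have h3 : (0 : ℝ) ≤ 1 / (1 - p) * ∑ j ∈ Finset.range k, 1 / ((j : ℝ) + 1) :=
    mul_nonneg (by positivity) (Finset.sum_nonneg fun j _ => by positivity)
  have h4 : 0 ≤ 2 * p / (1 - p) * waitSum n p k * D := by positivity
  have h5 : (0 : ℝ) ≤ if b = 0 then 1 / p else 0 := by split_ifs <;> positivity
  have h6 : 0 ≤ 4 * n * waitSum n p k := by positivity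
  unfold upperProfile
  linarith

lemma upperProfile_mono (hn : 0 < n) (hp0 : 0 < p) (hp1 : p < 1) (k b : ℕ) {D D' : ℝ}
    (h : D' ≤ D) : upperProfile n p k b D' ≤ upperProfile n p k b D := by
  have hq : 0 < 1 - p := by linarith
  have hS := waitSum_nonneg hn hp0 hp1 k
  unfold upperProfile
  gcongr

lemma upperProfile_le_add (hn : 0 < n) (hp0 : 0 < p) (hp1 : p < 1) {k : ℕ} (hk : k ≤ n) (b : ℕ)
    {D D' : ℝ} (h : D' ≤ D + 1) :
    upperProfile n p k b D' ≤ upperProfile n p k b D + 2 * p / (1 - p) * waitSum n p n := by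
  have hq : 0 < 1 - p := by linarith
  have hS := waitSum_mono hn hp0 hp1 hk
  have hJ : 2 * p / (1 - p) * waitSum n p k ≤ 2 * p / (1 - p) * waitSum n p n := by gcongr
  refine (upperProfile_mono hn hp0 hp1 k b h).trans ?_
  unfold upperProfile
  linarith

/-- An annihilation with `b + 1` blue particles in the core before and `b` after it. -/
lemma upperProfile_kill (hn : 0 < n) (hp0 : 0 < p) (hp1 : p < 1) {k b : ℕ} (hb : b ≤ k) {D D' : ℝ}
    (h : D' ≤ D) :
    upperProfile n p k b D' ≤ upperProfile n p (k + 1) (b + 1) D -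
      (4 * n * wait n p (k + 1) + 1 / (1 - p) * (1 / ((k : ℝ) + 1)) +
        2 * p / (1 - p) * wait n p (k + 1) * D) := by
  refine (upperProfile_mono hn hp0 hp1 k b h).trans ?_
  have h1 := mul_wait_sub_le hn hp0 hp1 k
  have h2 := mul_wait_le hn hp0 hp1 k
  have h3 := killBonus_ge hn hp0 hp1
  have h4 : (if b = 0 then 1 / p else 0) ≤ 1 / p := by
    split_ifs
    · exact le_rfl
    · positivity
  have h5 := mul_wait_mono hn hp0 hp1 k
  push_cast at h5
  have h6 : (b + 1 : ℝ) * ((k + 1) * wait n p (k + 1) - k * wait n p k) ≤ 1 / p := by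
    refine le_trans (mul_le_mul_of_nonneg_right ?_ (by linarith)) h1
    exact_mod_cast Nat.succ_le_succ hb
  have h7 : 4 / p = 4 * (1 / p) := by ring
  have h8 : (0 : ℝ) < 1 / p := by positivity
  rw [upperProfile, upperProfile, waitSum_succ, Finset.sum_range_succ, if_neg b.succ_ne_zero]
  push_cast
  linarith

/-- An annihilation without blue particles in the core. -/
lemma upperProfile_kill_zero (hn : 0 < n) (hp0 : 0 < p) (hp1 : p < 1) (k : ℕ) {D D' : ℝ}
    (hD : 0 ≤ D) (h : D' ≤ D) :
    upperProfile n p k 0 D' ≤ upperProfile n p (k + 1) 0 D - killBonus n p := by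
  refine (upperProfile_mono hn hp0 hp1 k 0 h).trans ?_
  have hq : 0 < 1 - p := by linarith
  have hr := wait_pos hn hp0 hp1 (k + 1)
  have h1 : 0 ≤ 4 * n * wait n p (k + 1) := by positivity
  have h2 : 0 ≤ 2 * p / (1 - p) * wait n p (k + 1) * D := by positivity
  have h3 : 0 ≤ 1 / (1 - p) * (1 / ((k : ℝ) + 1)) := by positivity
  rw [upperProfile, upperProfile, waitSum_succ, Finset.sum_range_succ]
  push_cast
  linarith

lemma upperProfile_enter (n : ℕ) (hp0 : 0 < p) (k b : ℕ) (D : ℝ) :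
    upperProfile n p k (b + 1) D ≤ upperProfile n p k b D - k * wait n p k := by
  have : (0 : ℝ) ≤ if b = 0 then 1 / p else 0 := by split_ifs <;> positivity
  rw [upperProfile, upperProfile, if_neg b.succ_ne_zero]
  push_cast
  linarith

lemma upperProfile_enter_zero (hn : 0 < n) (hp0 : 0 < p) (hp1 : p < 1) (k : ℕ) (D : ℝ) :
    upperProfile n p k 1 D ≤ upperProfile n p k 0 D - 1 / p := by
  have : 0 ≤ k * wait n p k := mul_nonneg (Nat.cast_nonneg k) (wait_pos hn hp0 hp1 k).le
  rw [upperProfile, upperProfile, if_neg one_ne_zero, if_pos rfl]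
  push_cast
  linarith

lemma upperProfile_leave (n : ℕ) (p : ℝ) (k b : ℕ) (D : ℝ) :
    upperProfile n p k b D = upperProfile n p k (b + 1) D + k * wait n p k +
      (if b = 0 then 1 / p else 0) := by
  rw [upperProfile, upperProfile, if_neg b.succ_ne_zero]
  push_cast
  ring

/-- The exact cancellation behind the upper Lyapunov function: with `b + 1` blue particles in the
core, the drift of the `b`-linear correction turns the annihilation rate into its mean value, the
loss caused by the excess `D` is paid by the red annihilations, and so is the cost of leaving the
core without blue particles. -/
lemma upper_drift_identity (hn : 0 < n) (hp0 : 0 < p) (hp1 : p < 1) {k b : ℕ} (hb : b ≤ k)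
    {u D : ℝ} (hD : 0 ≤ D) (hDk : D ≤ (k + 1 : ℕ)) :
    p * (((b + 1 : ℕ) * (((k + 1 : ℕ) - D) * (u - 4 * n * wait n p (k + 1)) +
          ((2 * n : ℕ) - ((k + 1 : ℕ) - D)) *
            (u + (k + 1 : ℕ) * wait n p (k + 1) + (if b = 0 then 1 / p else 0))) / (2 * n : ℕ) +
        ((k + 1 : ℕ) - (b + 1 : ℕ)) * (u - (k + 1 : ℕ) * wait n p (k + 1))) / (k + 1 : ℕ)) +
      (1 - p) * (u - (4 * n * wait n p (k + 1) + 1 / (1 - p) * (1 / ((k : ℝ) + 1)) +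
        2 * p / (1 - p) * wait n p (k + 1) * D)) ≤ u - 1 := by
  have hN : (0 : ℝ) < n := by exact_mod_cast hn
  have hq : 0 < 1 - p := by linarith
  have hw := wait_pos hn hp0 hp1 (k + 1)
  have hwm := wait_mul hn hp0 hp1 (k + 1)
  have hK : (0 : ℝ) < (k + 1 : ℕ) := by positivity
  have hB : ((b + 1 : ℕ) : ℝ) ≤ (k + 1 : ℕ) := by exact_mod_cast Nat.succ_le_succ hb
  have hB0 : (0 : ℝ) < (b + 1 : ℕ) := by positivity
  have hε0 : (0 : ℝ) ≤ if b = 0 then 1 / p else 0 := by split_ifs <;> positivity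
  have hε : ((b + 1 : ℕ) : ℝ) * (if b = 0 then 1 / p else 0) ≤ 1 / p := by
    split_ifs with h0
    · simp [h0]
    · simp; positivity
  have hKk : (1 : ℝ) / ((k : ℝ) + 1) = 1 / (k + 1 : ℕ) := by push_cast; rfl
  have hcast : ((2 * n : ℕ) : ℝ) = 2 * n := by push_cast; rfl
  rw [hKk, hcast]
  generalize (if b = 0 then 1 / p else 0 : ℝ) = ε at *
  generalize wait n p (k + 1) = w at *
  generalize ((k + 1 : ℕ) : ℝ) = K at *
  generalize ((b + 1 : ℕ) : ℝ) = B at *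
  generalize (n : ℝ) = N at *
  have h1 : B / K * D * w ≤ D * w := by
    have : B / K ≤ 1 := (div_le_one hK).2 hB
    have := mul_le_mul_of_nonneg_right this (mul_nonneg hD hw.le)
    linarith
  have h2 : p * (B * ε / K) ≤ 1 / K := by
    rw [← mul_div_assoc]
    gcongr
    calc p * (B * ε) ≤ p * (1 / p) := by gcongr
      _ = 1 := by field_simp
  have h3 : 0 ≤ p * (B / K * ((K - D) / (2 * N)) * (K * w + ε)) := by
    have : 0 ≤ K - D := by linarith
    positivity
  have heq : p * ((B * ((K - D) * (u - 4 * N * w) + (2 * N - (K - D)) * (u + K * w + ε)) /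
        (2 * N) + (K - B) * (u - K * w)) / K) +
      (1 - p) * (u - (4 * N * w + 1 / (1 - p) * (1 / K) + 2 * p / (1 - p) * w * D)) =
      u - (p * K * w + 4 * N * (1 - p) * w) + 2 * p * (B / K * D * w - D * w) +
        (p * (B * ε / K) - 1 / K) - p * (B / K * ((K - D) / (2 * N)) * (K * w + ε)) := by
    field_simp
    ring
  have h4 := mul_le_mul_of_nonneg_left h1 hp0.le
  rw [heq, hwm]
  linarith

end Upper

lemma card_cons_erase {α : Type*} [DecidableEq α] {s : Multiset α} {v : α} (hv : v ∈ s) (w : α) :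
    Multiset.card (w ::ₘ s.erase v) = Multiset.card s := by
  rw [Multiset.card_cons, Multiset.card_erase_add_one hv]

section UpperDrift

variable {n : ℕ} {p : ℝ}

lemma upperFn_nonneg (hn : 0 < n) (hp0 : 0 < p) (hp1 : p < 1) {m : ℕ}
    (x : Config (Unit ⊕ Fin m)) : 0 ≤ upperFn n p x :=
  upperProfile_nonneg hn hp0 hp1 (Multiset.count_le_card _ _) (excess_nonneg _)

/-- The drift of the upper Lyapunov function while blue particles occupy the core. -/
lemma starMean_upperFn_le_of_mem (hn : 0 < n) (hp0 : 0 < p) (hp1 : p < 1)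
    {x : Config (Unit ⊕ Fin (2 * n))} (hx : Admissible n x) (hc : Sum.inl () ∈ x.blue) :
    starMean p (upperFn n p) x ≤ upperFn n p x - 1 := by
  have hcr : Sum.inl () ∉ x.red := hx.disjoint _ hc
  have hcard := hx.card_eq
  obtain ⟨b, hb⟩ : ∃ b, x.blue.count (Sum.inl ()) = b + 1 :=
    Nat.exists_eq_add_one.2 (Multiset.count_pos.2 hc)
  obtain ⟨k, hk⟩ : ∃ k, Multiset.card x.blue = k + 1 :=
    Nat.exists_eq_add_one.2 (Multiset.card_pos_iff_exists_mem.2 ⟨_, hc⟩)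
  have hbk : b ≤ k := by
    have := Multiset.count_le_card (Sum.inl ()) x.blue
    omega
  have hr : x.red ≠ 0 := by
    rintro h0
    rw [h0, hk] at hcard
    simp at hcard
  have hD := excess_nonneg x.red
  have hρ : (x.red.toFinset.card : ℝ) = (k + 1 : ℕ) - excess x.red := by
    rw [excess, hcard, hk]
    ring
  have hDk : excess x.red ≤ (k + 1 : ℕ) := by
    have : (0 : ℝ) ≤ x.red.toFinset.card := Nat.cast_nonneg _
    linarith
  have hkill : ∀ D' ≤ excess x.red, upperProfile n p k b D' ≤ upperFn n p x -
      (4 * n * wait n p (k + 1) + 1 / (1 - p) * (1 / ((k : ℝ) + 1)) +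
        2 * p / (1 - p) * wait n p (k + 1) * excess x.red) := by
    intro D' hD'
    rw [upperFn, hk, hb]
    exact upperProfile_kill hn hp0 hp1 hbk hD'
  have hblue : jumpMean x.blue (fun v w => upperFn n p (x.moveBlue v w)) ≤ _ :=
    jumpMean_le_of_core (m := 2 * n) (by omega) hcr
      (X := upperFn n p x + (k + 1 : ℕ) * wait n p (k + 1) + (if b = 0 then 1 / p else 0))
      (Y := upperFn n p x - (k + 1 : ℕ) * wait n p (k + 1))
      (Z := upperFn n p x - 4 * n * wait n p (k + 1))
      (fun i _ hi => by
        simp only [Config.moveBlue, if_pos hi]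
        rw [upperFn]
        dsimp only
        rw [Multiset.card_erase_of_mem hc, Multiset.count_erase_self, hk, hb]
        refine (hkill _ (excess_erase_le _ _)).trans ?_
        have hq : 0 < 1 - p := by linarith
        have := wait_pos hn hp0 hp1 (k + 1)
        have h1 : 0 ≤ 2 * p / (1 - p) * wait n p (k + 1) * excess x.red := by positivity
        have h2 : 0 ≤ 1 / (1 - p) * (1 / ((k : ℝ) + 1)) := by positivity
        linarith)
      (fun i _ hi => by
        simp only [Config.moveBlue, if_neg hi]
        rw [upperFn]
        dsimp only
        rw [card_cons_erase hc, Multiset.count_cons_of_ne (by simp), Multiset.count_erase_self, hk,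
          hb, upperFn, hk, hb]
        exact (upperProfile_leave n p (k + 1) b _).le)
      (fun i hi => by
        simp only [Config.moveBlue, if_neg hcr]
        rw [upperFn]
        dsimp only
        rw [card_cons_erase hi, Multiset.count_cons_self, Multiset.count_erase_of_ne (by simp),
          upperFn, hk, hb]
        exact upperProfile_enter n hp0 (k + 1) (b + 1) _)
  have hred : jumpMean x.red (fun v w => upperFn n p (x.moveRed v w)) ≤ upperFn n p x -
      (4 * n * wait n p (k + 1) + 1 / (1 - p) * (1 / ((k : ℝ) + 1)) +
        2 * p / (1 - p) * wait n p (k + 1) * excess x.red) :=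
    jumpMean_le (m := 2 * n) (by omega) hr (fun i h => absurd h hcr) (fun i hi => by
      simp only [Config.moveRed, if_pos hc]
      rw [upperFn]
      dsimp only
      rw [Multiset.card_erase_of_mem hc, Multiset.count_erase_self, hk, hb]
      exact hkill _ (excess_erase_le _ _))
  rw [hρ, hb, hk, ← mul_div_assoc] at hblue
  refine le_trans ?_ (upper_drift_identity hn hp0 hp1 hbk (u := upperFn n p x) hD hDk)
  unfold starMean
  have hq : 0 ≤ 1 - p := by linarith
  gcongr

/-- The drift of the upper Lyapunov function while the core is vacant. -/
lemma starMean_upperFn_le_of_notMem (hn : 0 < n) (hp0 : 0 < p) (hp1 : p < 1)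
    {x : Config (Unit ⊕ Fin (2 * n))} (hb : x.blue ≠ 0) (hr : x.red ≠ 0)
    (hcb : Sum.inl () ∉ x.blue) (hcr : Sum.inl () ∉ x.red) :
    starMean p (upperFn n p) x ≤ upperFn n p x - 1 := by
  have hcount : x.blue.count (Sum.inl ()) = 0 := Multiset.count_eq_zero.2 hcb
  have hblue : jumpMean x.blue (fun v w => upperFn n p (x.moveBlue v w)) ≤ upperFn n p x - 1 / p :=
    jumpMean_le (m := 2 * n) (by omega) hb (fun i h => absurd h hcb) (fun i hi => by
      simp only [Config.moveBlue, if_neg hcr]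
      rw [upperFn]
      dsimp only
      rw [card_cons_erase hi, Multiset.count_cons_self, Multiset.count_erase_of_ne (by simp),
        upperFn, hcount]
      exact upperProfile_enter_zero hn hp0 hp1 _ _)
  have hred : jumpMean x.red (fun v w => upperFn n p (x.moveRed v w)) ≤ upperFn n p x :=
    jumpMean_le (m := 2 * n) (by omega) hr (fun i h => absurd h hcr) (fun i hi => by
      simp only [Config.moveRed, if_neg hcb]
      refine upperProfile_mono hn hp0 hp1 _ _ ?_
      dsimp only
      rw [excess_cons_of_notMem fun h => hcr (Multiset.mem_of_mem_erase h)]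
      exact excess_erase_le _ _)
  have hq : 0 ≤ 1 - p := by linarith
  calc starMean p (upperFn n p) x ≤ p * (upperFn n p x - 1 / p) + (1 - p) * upperFn n p x := by
        unfold starMean
        gcongr
    _ = upperFn n p x - 1 := by
        field_simp
        ring

/-- The drift of the upper Lyapunov function while red particles occupy the core: the next blue
jump annihilates one of them, and its bonus pays for the excess that red jumps may create. -/
lemma starMean_upperFn_le_of_mem_red (hn : 0 < n) (hp0 : 0 < p) (hp1 : p < 1)
    {x : Config (Unit ⊕ Fin (2 * n))} (hx : Admissible n x) (hcr : Sum.inl () ∈ x.red) :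
    starMean p (upperFn n p) x ≤ upperFn n p x - 1 := by
  have hcb : Sum.inl () ∉ x.blue := fun h => hx.disjoint _ h hcr
  have hcount : x.blue.count (Sum.inl ()) = 0 := Multiset.count_eq_zero.2 hcb
  have hr : 0 < Multiset.card x.red := Multiset.card_pos_iff_exists_mem.2 ⟨_, hcr⟩
  have hcard := hx.card_eq
  obtain ⟨k, hk⟩ : ∃ k, Multiset.card x.blue = k + 1 := Nat.exists_eq_add_one.2 (by omega)
  have hq : 0 < 1 - p := by linarith
  have hD := excess_nonneg x.red
  have hK := killBonus_ge hn hp0 hp1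
  have hK0 : 0 ≤ killBonus n p := le_trans (by positivity) hK
  have hJ : 0 ≤ 2 * p / (1 - p) * waitSum n p n := by
    have := waitSum_nonneg hn hp0 hp1 n
    positivity
  have hblue : jumpMean x.blue (fun v w => upperFn n p (x.moveBlue v w)) ≤
      upperFn n p x - killBonus n p :=
    jumpMean_le (m := 2 * n) (by omega) (Multiset.card_pos.1 (by omega)) (fun i h => absurd h hcb)
      (fun i hi => by
        simp only [Config.moveBlue, if_pos hcr]
        rw [upperFn]
        dsimp only
        rw [Multiset.card_erase_of_mem hi, Multiset.count_erase_of_ne (by simp), upperFn, hcount,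
          hk]
        exact upperProfile_kill_zero hn hp0 hp1 k hD (excess_erase_le _ _))
  have hred : jumpMean x.red (fun v w => upperFn n p (x.moveRed v w)) ≤
      upperFn n p x + 2 * p / (1 - p) * waitSum n p n :=
    jumpMean_le (m := 2 * n) (by omega) (Multiset.card_pos.1 hr)
      (fun i _ => by
        by_cases hi : Sum.inr i ∈ x.blue
        · simp only [Config.moveRed, if_pos hi]
          rw [upperFn]
          dsimp only
          rw [Multiset.card_erase_of_mem hi, Multiset.count_erase_of_ne (by simp), upperFn, hcount,
            hk]
          have := upperProfile_kill_zero hn hp0 hp1 k hD (excess_erase_le x.red (Sum.inl ()))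
          rw [Nat.pred_succ]
          linarith
        · simp only [Config.moveRed, if_neg hi]
          refine upperProfile_le_add hn hp0 hp1 hx.card_le _ ?_
          exact (excess_cons_le _ _).trans (by linarith [excess_erase_le x.red (Sum.inl ())]))
      (fun i hi => by
        simp only [Config.moveRed, if_neg hcb]
        refine upperProfile_le_add hn hp0 hp1 hx.card_le _ ?_
        exact (excess_cons_le _ _).trans (by linarith [excess_erase_le x.red (Sum.inr i)]))
  have hpK := mul_killBonus (n := n) hp0
  calc starMean p (upperFn n p) x ≤ p * (upperFn n p x - killBonus n p) +
        (1 - p) * (upperFn n p x + 2 * p / (1 - p) * waitSum n p n) := by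
        unfold starMean
        gcongr
    _ = upperFn n p x - (p * killBonus n p - 2 * p * waitSum n p n) := by
        field_simp
        ring
    _ ≤ upperFn n p x - 1 := by
        rw [hpK]
        linarith

lemma starMean_upperFn_le (hn : 0 < n) (hp0 : 0 < p) (hp1 : p < 1)
    {x : Config (Unit ⊕ Fin (2 * n))} (hx : Admissible n x) (hb : x.blue ≠ 0) (hr : x.red ≠ 0) :
    starMean p (upperFn n p) x ≤ upperFn n p x - 1 := by
  by_cases hcb : Sum.inl () ∈ x.blue
  · exact starMean_upperFn_le_of_mem hn hp0 hp1 hx hcb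
  · by_cases hcr : Sum.inl () ∈ x.red
    · exact starMean_upperFn_le_of_mem_red hn hp0 hp1 hx hcr
    · exact starMean_upperFn_le_of_notMem hn hp0 hp1 hb hr hcb hcr

lemma starInit_admissible {B : Finset (Fin (2 * n))} (hB : B.card = n) :
    Admissible n (starInit B) := by
  refine ⟨?_, ?_, ?_⟩
  · simp only [starInit, Multiset.card_map, Finset.card_val, Finset.card_compl, Fintype.card_fin, hB]
    omega
  · simp [starInit, hB]
  · intro v hv hv'
    simp only [starInit, Multiset.mem_map, Finset.mem_val, Finset.mem_compl] at hv hv'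
    obtain ⟨i, hi, rfl⟩ := hv
    obtain ⟨j, hj, hji⟩ := hv'
    exact hj (Sum.inr_injective hji ▸ hi)

lemma upperFn_starInit {B : Finset (Fin (2 * n))} (hB : B.card = n) :
    upperFn n p (starInit B) = upperProfile n p n 0 0 := by
  have h1 : Multiset.card (starInit B).blue = n := by simp [starInit, hB]
  have h2 : (starInit B).blue.count (Sum.inl ()) = 0 :=
    Multiset.count_eq_zero.2 (by simp [starInit])
  have h3 : excess (starInit B).red = 0 := by
    have hnd : (starInit B).red.Nodup := (Bᶜ).nodup.map Sum.inr_injective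
    rw [excess, Multiset.toFinset_card_of_nodup hnd, sub_self]
  rw [upperFn, h1, h2, h3]

theorem starTime_le (p : unitInterval) (hn : 0 < n) (hp0 : 0 < (p : ℝ)) (hp1 : (p : ℝ) < 1)
    {B : Finset (Fin (2 * n))} (hB : B.card = n) :
    starTime p n B ≤ ENNReal.ofReal (upperProfile n p n 0 0) := by
  classical
  rw [← upperFn_starInit hB]
  -- Off the admissible configurations the drift condition holds because the function is infinite.
  let f : Config (Unit ⊕ Fin (2 * n)) → ENNReal := fun x =>
    if Admissible n x then ENNReal.ofReal (upperFn n p x) else ⊤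
  have hf : ∀ x, ∑' y, step (starGraph (2 * n)) p x y * f y + aliveInd x ≤ f x := by
    intro x
    by_cases hx : Admissible n x
    · by_cases ha : x.Alive
      · obtain ⟨hb, hr⟩ := hx.ne_zero_of_alive ha
        have hsum : ∑' y, step (starGraph (2 * n)) p x y * f y =
            ∑' y, step (starGraph (2 * n)) p x y * ENNReal.ofReal (upperFn n p y) := by
          refine tsum_congr fun y => ?_
          by_cases hy : step (starGraph (2 * n)) p x y = 0
          · simp [hy]
          · simp only [f, if_pos (hx.step hy)]
        have hnn : 0 ≤ starMean p (upperFn n p) x := by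
          have hq := sub_nonneg.2 p.2.2
          exact add_nonneg (mul_nonneg hp0.le (jumpMean_nonneg fun _ _ => upperFn_nonneg hn hp0 hp1 _))
            (mul_nonneg hq (jumpMean_nonneg fun _ _ => upperFn_nonneg hn hp0 hp1 _))
        rw [hsum, tsum_step_mul (by omega) p hb hr fun y => upperFn_nonneg hn hp0 hp1 y,
          aliveInd_of_alive ha, ← ENNReal.ofReal_one, ← ENNReal.ofReal_add hnn zero_le_one]
        simp only [f, if_pos hx]
        exact ENNReal.ofReal_le_ofReal (by linarith [starMean_upperFn_le hn hp0 hp1 hx hb hr])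
      · rw [step_of_not_alive ha, aliveInd_of_not_alive ha, add_zero, tsum_eq_single x]
        · simp
        · intro y hy
          simp [hy]
    · simp only [f, if_neg hx]
      exact le_top
  refine (expectedTime_le_of_drift hf (starInit B)).trans (le_of_eq ?_)
  simp only [f, if_pos (starInit_admissible hB)]

end UpperDrift

/-! ### The lower bound -/

/-- The lower Lyapunov function of `k` pairs and `b` blue particles in the core. -/
noncomputable def lowerProfile (n : ℕ) (p : ℝ) (k b : ℕ) : ℝ :=
  4 * n * waitSum n p k - b * (k * wait n p k)

/-- The lower Lyapunov function on the configurations on the star graph. The red particles in the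
core do not count: they are annihilated by the next blue jump. -/
noncomputable def lowerFn (n : ℕ) (p : ℝ) {m : ℕ} (x : Config (Unit ⊕ Fin m)) : ℝ :=
  max 0 (lowerProfile n p (Multiset.card x.blue - x.red.count (Sum.inl ()))
    (x.blue.count (Sum.inl ())))

section Lower

variable {n : ℕ} {p : ℝ}

lemma le_lowerFn {m : ℕ} {x : Config (Unit ⊕ Fin m)} {k b : ℕ}
    (hk : Multiset.card x.blue - x.red.count (Sum.inl ()) = k)
    (hb : x.blue.count (Sum.inl ()) = b) : lowerProfile n p k b ≤ lowerFn n p x := by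
  rw [lowerFn, hk, hb]
  exact le_max_right _ _

/-- An annihilation with `b + 1` blue particles in the core before and `b` after it. -/
lemma lowerProfile_kill (hn : 0 < n) (hp0 : 0 < p) (hp1 : p < 1) (k b : ℕ) :
    lowerProfile n p (k + 1) (b + 1) + (k + 1 : ℕ) * wait n p (k + 1) -
      4 * n * wait n p (k + 1) ≤ lowerProfile n p k b := by
  have h := mul_le_mul_of_nonneg_left (mul_wait_mono hn hp0 hp1 k) (Nat.cast_nonneg (α := ℝ) b)
  rw [lowerProfile, lowerProfile, waitSum_succ]
  push_cast at *
  linarith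

/-- The exact cancellation behind the lower Lyapunov function: with `b + 1` blue particles in the
core and `ρ` leaves occupied by red ones, the drift of the `b`-linear correction turns the
annihilation rate into its mean value. -/
lemma lower_drift_identity (hn : 0 < n) (hp0 : 0 < p) (hp1 : p < 1) (k b : ℕ) {u ρ : ℝ}
    (hρ : ρ ≤ (k + 1 : ℕ)) :
    u - 1 ≤ p * (((b + 1 : ℕ) * ((ρ * (u + (k + 1 : ℕ) * wait n p (k + 1) -
          4 * n * wait n p (k + 1)) +
          ((2 * n : ℕ) - ρ) * (u + (k + 1 : ℕ) * wait n p (k + 1))) / (2 * n : ℕ)) +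
        ((k + 1 : ℕ) - (b + 1 : ℕ)) * (u - (k + 1 : ℕ) * wait n p (k + 1))) / (k + 1 : ℕ)) +
      (1 - p) * (u - 4 * n * wait n p (k + 1)) := by
  have hN : (0 : ℝ) < n := by exact_mod_cast hn
  have hw := wait_pos hn hp0 hp1 (k + 1)
  have hwm := wait_mul hn hp0 hp1 (k + 1)
  have hK : (0 : ℝ) < (k + 1 : ℕ) := by positivity
  have hB0 : (0 : ℝ) < (b + 1 : ℕ) := by positivity
  have hcast : ((2 * n : ℕ) : ℝ) = 2 * n := by push_cast; rfl
  rw [hcast]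
  generalize wait n p (k + 1) = w at *
  generalize ((k + 1 : ℕ) : ℝ) = K at *
  generalize ((b + 1 : ℕ) : ℝ) = B at *
  generalize (n : ℝ) = N at *
  have h0 : 0 ≤ 2 * p * (B * w * ((K - ρ) / K)) := by
    have : 0 ≤ K - ρ := by linarith
    positivity
  have heq : p * ((B * ((ρ * (u + K * w - 4 * N * w) + (2 * N - ρ) * (u + K * w)) / (2 * N)) +
        (K - B) * (u - K * w)) / K) + (1 - p) * (u - 4 * N * w) =
      u - (p * K * w + 4 * N * (1 - p) * w) + 2 * p * (B * w * ((K - ρ) / K)) := by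
    field_simp
    ring
  rw [heq, hwm]
  linarith

/-- The drift of the lower Lyapunov function while blue particles occupy the core. -/
lemma le_starMean_lowerFn_of_mem (hn : 0 < n) (hp0 : 0 < p) (hp1 : p < 1)
    {x : Config (Unit ⊕ Fin (2 * n))} (hx : Admissible n x) (hc : Sum.inl () ∈ x.blue) :
    lowerProfile n p (Multiset.card x.blue - x.red.count (Sum.inl ()))
      (x.blue.count (Sum.inl ())) - 1 ≤ starMean p (lowerFn n p) x := by
  have hcr : Sum.inl () ∉ x.red := hx.disjoint _ hc
  have hr0 : x.red.count (Sum.inl ()) = 0 := Multiset.count_eq_zero.2 hcr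
  have hcard := hx.card_eq
  obtain ⟨b, hb⟩ : ∃ b, x.blue.count (Sum.inl ()) = b + 1 :=
    Nat.exists_eq_add_one.2 (Multiset.count_pos.2 hc)
  obtain ⟨k, hk⟩ : ∃ k, Multiset.card x.blue = k + 1 :=
    Nat.exists_eq_add_one.2 (Multiset.card_pos_iff_exists_mem.2 ⟨_, hc⟩)
  have hr : x.red ≠ 0 := Multiset.card_pos.1 (by omega)
  have hρ : (x.red.toFinset.card : ℝ) ≤ (k + 1 : ℕ) := by
    have := Multiset.toFinset_card_le x.red
    rw [hcard, hk] at this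
    exact_mod_cast this
  rw [hr0, hk, hb, Nat.sub_zero]
  have hkill := lowerProfile_kill hn hp0 hp1 k b
  have hg : (0 : ℝ) ≤ (k + 1 : ℕ) * wait n p (k + 1) :=
    mul_nonneg (Nat.cast_nonneg _) (wait_pos hn hp0 hp1 _).le
  set u := lowerProfile n p (k + 1) (b + 1) with hu
  have hblue : jumpMean x.blue (fun v w => -lowerFn n p (x.moveBlue v w)) ≤ _ :=
    jumpMean_le_of_core (m := 2 * n) (by omega) hcr
      (X := -(u + (k + 1 : ℕ) * wait n p (k + 1)))
      (Y := -(u - (k + 1 : ℕ) * wait n p (k + 1)))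
      (Z := -(u + (k + 1 : ℕ) * wait n p (k + 1) - 4 * n * wait n p (k + 1)))
      (fun i _ hi => by
        refine neg_le_neg (hkill.trans (le_lowerFn ?_ ?_)) <;>
          simp only [Config.moveBlue, if_pos hi]
        · rw [Multiset.card_erase_of_mem hc, Multiset.count_erase_of_ne (by simp), hr0, hk]
          simp
        · rw [Multiset.count_erase_self, hb, Nat.add_sub_cancel])
      (fun i _ hi => by
        refine neg_le_neg (le_trans ?_ (le_lowerFn (k := k + 1) (b := b) ?_ ?_))
        · rw [hu, lowerProfile, lowerProfile]
          push_cast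
          linarith
        · simp only [Config.moveBlue, if_neg hi]
          rw [card_cons_erase hc, hr0, hk, Nat.sub_zero]
        · simp only [Config.moveBlue, if_neg hi]
          rw [Multiset.count_cons_of_ne (by simp), Multiset.count_erase_self, hb,
            Nat.add_sub_cancel])
      (fun i hi => by
        refine neg_le_neg (le_trans ?_ (le_lowerFn (k := k + 1) (b := b + 2) ?_ ?_))
        · rw [hu, lowerProfile, lowerProfile]
          push_cast
          linarith
        · simp only [Config.moveBlue, if_neg hcr]
          rw [card_cons_erase hi, hr0, hk, Nat.sub_zero]
        · simp only [Config.moveBlue, if_neg hcr]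
          rw [Multiset.count_cons_self, Multiset.count_erase_of_ne (by simp), hb])
  have hred : jumpMean x.red (fun v w => -lowerFn n p (x.moveRed v w)) ≤
      -(u - 4 * n * wait n p (k + 1)) :=
    jumpMean_le (m := 2 * n) (by omega) hr (fun i h => absurd h hcr) (fun i hi => by
      refine neg_le_neg (le_trans ?_ (hkill.trans (le_lowerFn ?_ ?_)))
      · linarith
      · simp only [Config.moveRed, if_pos hc]
        rw [Multiset.card_erase_of_mem hc, Multiset.count_erase_of_ne (by simp), hr0, hk]
        simp
      · simp only [Config.moveRed, if_pos hc]
        rw [Multiset.count_erase_self, hb, Nat.add_sub_cancel])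
  rw [jumpMean_neg, hb, hk] at hblue
  rw [jumpMean_neg] at hred
  refine (lower_drift_identity hn hp0 hp1 k b hρ).trans ?_
  unfold starMean
  have hq : 0 ≤ 1 - p := by linarith
  refine add_le_add (mul_le_mul_of_nonneg_left ?_ hp0.le)
    (mul_le_mul_of_nonneg_left (neg_le_neg_iff.1 hred) hq)
  refine neg_le_neg_iff.1 (hblue.trans (le_of_eq ?_))
  ring

/-- The drift of the lower Lyapunov function while the core is vacant. -/
lemma le_starMean_lowerFn_of_notMem (hn : 0 < n) (hp0 : 0 < p) (hp1 : p < 1)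
    {x : Config (Unit ⊕ Fin (2 * n))} (hx : Admissible n x) (hb : x.blue ≠ 0)
    (hcb : Sum.inl () ∉ x.blue) (hcr : Sum.inl () ∉ x.red) :
    lowerProfile n p (Multiset.card x.blue - x.red.count (Sum.inl ()))
      (x.blue.count (Sum.inl ())) - 1 ≤ starMean p (lowerFn n p) x := by
  have hr0 : x.red.count (Sum.inl ()) = 0 := Multiset.count_eq_zero.2 hcr
  have hb0 : x.blue.count (Sum.inl ()) = 0 := Multiset.count_eq_zero.2 hcb
  have hcard := hx.card_eq
  obtain ⟨k, hk⟩ : ∃ k, Multiset.card x.blue = k + 1 :=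
    Nat.exists_eq_add_one.2 (Multiset.card_pos.2 hb)
  rw [hr0, hb0, hk, Nat.sub_zero]
  have hwm := wait_mul hn hp0 hp1 (k + 1)
  set u := lowerProfile n p (k + 1) 0 with hu
  have hblue : jumpMean x.blue (fun v w => -lowerFn n p (x.moveBlue v w)) ≤
      -(u - (k + 1 : ℕ) * wait n p (k + 1)) :=
    jumpMean_le (m := 2 * n) (by omega) hb (fun i h => absurd h hcb) (fun i hi => by
      refine neg_le_neg (le_trans ?_ (le_lowerFn (k := k + 1) (b := 1) ?_ ?_))
      · rw [hu, lowerProfile, lowerProfile]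
        push_cast
        linarith
      · simp only [Config.moveBlue, if_neg hcr]
        rw [card_cons_erase hi, hr0, hk, Nat.sub_zero]
      · simp only [Config.moveBlue, if_neg hcr]
        rw [Multiset.count_cons_self, Multiset.count_erase_of_ne (by simp), hb0])
  have hred : jumpMean x.red (fun v w => -lowerFn n p (x.moveRed v w)) ≤
      -(u - 4 * n * wait n p (k + 1)) :=
    jumpMean_le (m := 2 * n) (by omega) (Multiset.card_pos.1 (by omega)) (fun i h => absurd h hcr)
      (fun i hi => by
        refine neg_le_neg (le_trans ?_ (le_lowerFn (k := k) (b := 0) ?_ ?_))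
        · rw [hu, lowerProfile, lowerProfile, waitSum_succ]
          push_cast
          linarith
        · simp only [Config.moveRed, if_neg hcb]
          rw [Multiset.count_cons_self, Multiset.count_erase_of_ne (by simp), hr0, hk]
          simp
        · simp only [Config.moveRed, if_neg hcb]
          exact hb0)
  rw [jumpMean_neg, neg_le_neg_iff] at hblue hred
  have hq : 0 ≤ 1 - p := by linarith
  calc u - 1 = p * (u - (k + 1 : ℕ) * wait n p (k + 1)) +
        (1 - p) * (u - 4 * n * wait n p (k + 1)) := by linear_combination hwm
    _ ≤ starMean p (lowerFn n p) x := by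
        unfold starMean
        gcongr

/-- The drift of the lower Lyapunov function while red particles occupy the core. -/
lemma le_starMean_lowerFn_of_mem_red (hn : 0 < n) (hp0 : 0 < p) (hp1 : p < 1)
    {x : Config (Unit ⊕ Fin (2 * n))} (hx : Admissible n x) (hcr : Sum.inl () ∈ x.red) :
    lowerProfile n p (Multiset.card x.blue - x.red.count (Sum.inl ()))
      (x.blue.count (Sum.inl ())) - 1 ≤ starMean p (lowerFn n p) x := by
  have hcb : Sum.inl () ∉ x.blue := fun h => hx.disjoint _ h hcr
  have hb0 : x.blue.count (Sum.inl ()) = 0 := Multiset.count_eq_zero.2 hcb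
  have hr : 0 < Multiset.card x.red := Multiset.card_pos_iff_exists_mem.2 ⟨_, hcr⟩
  have hcard := hx.card_eq
  have hq : 0 < 1 - p := by linarith
  have hN : (0 : ℝ) < n := by exact_mod_cast hn
  obtain ⟨r, hr1⟩ : ∃ r, x.red.count (Sum.inl ()) = r + 1 :=
    Nat.exists_eq_add_one.2 (Multiset.count_pos.2 hcr)
  obtain ⟨k, hk⟩ : ∃ k, Multiset.card x.blue = k + 1 := Nat.exists_eq_add_one.2 (by omega)
  have hmono : ∀ j j', j ≤ j' → lowerProfile n p j 0 ≤ lowerProfile n p j' 0 := by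
    intro j j' h
    have := waitSum_mono hn hp0 hp1 h
    simp only [lowerProfile, Nat.cast_zero, zero_mul, sub_zero]
    gcongr
  rw [hb0, hr1, hk, Nat.add_sub_add_right]
  set u := lowerProfile n p (k - r) 0 with hu
  have hinv : 0 ≤ 1 / (1 - p) := by positivity
  have hblue : jumpMean x.blue (fun v w => -lowerFn n p (x.moveBlue v w)) ≤ -u :=
    jumpMean_le (m := 2 * n) (by omega) (Multiset.card_pos.1 (by omega)) (fun i h => absurd h hcb)
      (fun i hi => by
        refine neg_le_neg (le_lowerFn ?_ ?_) <;> simp only [Config.moveBlue, if_pos hcr]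
        · rw [Multiset.card_erase_of_mem hi, Multiset.count_erase_self, hr1, hk]
          simp
        · rw [Multiset.count_erase_of_ne (by simp), hb0])
  have hred : jumpMean x.red (fun v w => -lowerFn n p (x.moveRed v w)) ≤ -(u - 1 / (1 - p)) :=
    jumpMean_le (m := 2 * n) (by omega) (Multiset.card_pos.1 hr)
      (fun i _ => by
        by_cases hi : Sum.inr i ∈ x.blue
        · refine neg_le_neg (le_trans (sub_le_self u hinv) (le_lowerFn ?_ ?_)) <;>
            simp only [Config.moveRed, if_pos hi]
          · rw [Multiset.card_erase_of_mem hi, Multiset.count_erase_self, hr1, hk]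
            simp
          · rw [Multiset.count_erase_of_ne (by simp), hb0]
        · refine neg_le_neg (le_trans (sub_le_self u hinv) ((hmono _ (k + 1 - r) (by omega)).trans
            (le_lowerFn ?_ ?_))) <;> simp only [Config.moveRed, if_neg hi]
          · rw [Multiset.count_cons_of_ne (by simp), Multiset.count_erase_self, hr1, hk]
            simp
          · exact hb0)
      (fun i hi => by
        -- A red particle on a leaf forces `r < k`.
        obtain ⟨j, hj⟩ : ∃ j, k - r = j + 1 := by
          have h1 := Multiset.count_le_card (Sum.inl ()) (x.red.erase (Sum.inr i))
          rw [Multiset.count_erase_of_ne (by simp), hr1, Multiset.card_erase_of_mem hi, hcard, hk,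
            Nat.pred_succ] at h1
          exact Nat.exists_eq_add_one.2 (by omega)
        refine neg_le_neg (le_trans ?_ (le_lowerFn (k := j) (b := 0) ?_ ?_))
        · have h1 := wait_mul hn hp0 hp1 (j + 1)
          have h2 : 0 ≤ p * (j + 1 : ℕ) * wait n p (j + 1) :=
            mul_nonneg (by positivity) (wait_pos hn hp0 hp1 _).le
          have h3 : 4 * n * wait n p (j + 1) ≤ 1 / (1 - p) := by
            rw [le_div_iff₀ hq]
            linarith
          rw [hu, hj, lowerProfile, lowerProfile, waitSum_succ]
          push_cast
          linarith
        · simp only [Config.moveRed, if_neg hcb]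
          rw [Multiset.count_cons_self, Multiset.count_erase_of_ne (by simp), hr1, hk]
          omega
        · simp only [Config.moveRed, if_neg hcb]
          exact hb0)
  rw [jumpMean_neg, neg_le_neg_iff] at hblue hred
  calc u - 1 = p * u + (1 - p) * (u - 1 / (1 - p)) := by
        field_simp
        ring
    _ ≤ starMean p (lowerFn n p) x := by
        unfold starMean
        gcongr

lemma lowerFn_nonneg {m : ℕ} (x : Config (Unit ⊕ Fin m)) : 0 ≤ lowerFn n p x := le_max_left _ _

lemma starMean_lowerFn_nonneg (hp0 : 0 < p) (hp1 : p < 1) {m : ℕ} (x : Config (Unit ⊕ Fin m)) :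
    0 ≤ starMean p (lowerFn n p) x :=
  add_nonneg (mul_nonneg hp0.le (jumpMean_nonneg fun _ _ => lowerFn_nonneg _))
    (mul_nonneg (by linarith) (jumpMean_nonneg fun _ _ => lowerFn_nonneg _))

lemma lowerFn_le_starMean (hn : 0 < n) (hp0 : 0 < p) (hp1 : p < 1)
    {x : Config (Unit ⊕ Fin (2 * n))} (hx : Admissible n x) (hb : x.blue ≠ 0) :
    lowerFn n p x ≤ starMean p (lowerFn n p) x + 1 := by
  have h0 := starMean_lowerFn_nonneg (n := n) hp0 hp1 x
  refine max_le (by linarith) (sub_le_iff_le_add.1 ?_)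
  by_cases hcb : Sum.inl () ∈ x.blue
  · exact le_starMean_lowerFn_of_mem hn hp0 hp1 hx hcb
  · by_cases hcr : Sum.inl () ∈ x.red
    · exact le_starMean_lowerFn_of_mem_red hn hp0 hp1 hx hcr
    · exact le_starMean_lowerFn_of_notMem hn hp0 hp1 hx hb hcb hcr

lemma lowerFn_le (hn : 0 < n) (hp0 : 0 < p) (hp1 : p < 1) {m : ℕ} {x : Config (Unit ⊕ Fin m)}
    (hx : Admissible n x) : lowerFn n p x ≤ 4 * n * waitSum n p n := by
  have hS := waitSum_nonneg hn hp0 hp1 n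
  refine max_le (by positivity) ?_
  have h1 := waitSum_mono hn hp0 hp1
    ((Nat.sub_le (Multiset.card x.blue) (x.red.count (Sum.inl ()))).trans hx.card_le)
  generalize Multiset.card x.blue - x.red.count (Sum.inl ()) = k at *
  have h2 : 0 ≤ (x.blue.count (Sum.inl ()) : ℝ) * (k * wait n p k) :=
    mul_nonneg (Nat.cast_nonneg _) (mul_nonneg (Nat.cast_nonneg _) (wait_pos hn hp0 hp1 k).le)
  have h3 : 4 * n * waitSum n p k ≤ 4 * n * waitSum n p n := by gcongr
  rw [lowerProfile]
  linarith

lemma lowerFn_of_not_alive {m : ℕ} {x : Config (Unit ⊕ Fin m)} (hx : ¬ x.Alive) :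
    lowerFn n p x = 0 := by
  have h := not_not.1 hx
  simp [lowerFn, lowerProfile, h.1, waitSum]

theorem le_starTime (p : unitInterval) (hn : 0 < n) (hp0 : 0 < (p : ℝ)) (hp1 : (p : ℝ) < 1)
    {B : Finset (Fin (2 * n))} (hB : B.card = n) :
    ENNReal.ofReal (4 * n * waitSum n p n) ≤ starTime p n B := by
  classical
  have hadm := starInit_admissible hB
  -- Off the admissible configurations the drift condition holds because the function vanishes.
  let f : Config (Unit ⊕ Fin (2 * n)) → ENNReal := fun x =>
    if Admissible n x then ENNReal.ofReal (lowerFn n p x) else 0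
  have hM : ∀ x, f x ≤ (4 * n * waitSum n p n).toNNReal * aliveInd x := by
    intro x
    by_cases hx : Admissible n x
    · simp only [f, if_pos hx]
      by_cases ha : x.Alive
      · rw [aliveInd_of_alive ha, mul_one]
        exact ENNReal.ofReal_le_ofReal (lowerFn_le hn hp0 hp1 hx)
      · simp [lowerFn_of_not_alive ha]
    · simp [f, if_neg hx]
  have hf : ∀ x, f x ≤ ∑' y, step (starGraph (2 * n)) p x y * f y + aliveInd x := by
    intro x
    by_cases hx : Admissible n x
    · by_cases ha : x.Alive
      · obtain ⟨hb, hr⟩ := hx.ne_zero_of_alive ha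
        have hsum : ∑' y, step (starGraph (2 * n)) p x y * f y =
            ∑' y, step (starGraph (2 * n)) p x y * ENNReal.ofReal (lowerFn n p y) := by
          refine tsum_congr fun y => ?_
          by_cases hy : step (starGraph (2 * n)) p x y = 0
          · simp [hy]
          · simp only [f, if_pos (hx.step hy)]
        rw [hsum, tsum_step_mul (by omega) p hb hr lowerFn_nonneg,
          aliveInd_of_alive ha, ← ENNReal.ofReal_one,
          ← ENNReal.ofReal_add (starMean_lowerFn_nonneg hp0 hp1 x) zero_le_one]
        simp only [f, if_pos hx]
        exact ENNReal.ofReal_le_ofReal (lowerFn_le_starMean hn hp0 hp1 hx hb)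
      · simp [f, lowerFn_of_not_alive ha]
    · simp [f, if_neg hx]
  refine le_trans ?_ (le_expectedTime_of_drift hM hf (starInit B))
  simp only [f, if_pos hadm]
  refine ENNReal.ofReal_le_ofReal (le_trans (le_of_eq ?_) (le_lowerFn (k := n) (b := 0) ?_ ?_))
  · simp [lowerProfile]
  · rw [Multiset.count_eq_zero.2 (by simp [starInit])]
    simp [starInit, hB]
  · exact Multiset.count_eq_zero.2 (by simp [starInit])

end Lower

/-! ### Asymptotics in the number of leaves -/

section Asymptotics

variable {n : ℕ} {p : ℝ}

lemma waitSum_le_log (hn : 0 < n) (hp0 : 0 < p) (hp1 : p < 1) :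
    p * waitSum n p n ≤ Real.log (1 / (1 - p)) := by
  have hN : (0 : ℝ) < n := by exact_mod_cast hn
  have hq : 0 < 1 - p := by linarith
  have key : ∀ k : ℕ, p * waitSum n p k ≤
      Real.log ((p * k + 4 * n * (1 - p)) / (4 * n * (1 - p))) := by
    intro k
    induction k with
    | zero =>
      have : 4 * n * (1 - p) ≠ 0 := by positivity
      simp [waitSum, div_self this]
    | succ k ih =>
      have hd := wait_denom_pos hn hp0 hp1 k
      have hd' := wait_denom_pos hn hp0 hp1 (k + 1)
      have ha : 0 < 4 * n * (1 - p) := by positivity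
      have h1 := Real.one_sub_inv_le_log_of_pos (div_pos hd' hd)
      have h2 : p * wait n p (k + 1) =
          1 - ((p * (k + 1 : ℕ) + 4 * n * (1 - p)) / (p * k + 4 * n * (1 - p)))⁻¹ := by
        rw [inv_div, wait, eq_sub_iff_add_eq, ← div_eq_mul_inv, ← add_div, div_eq_one_iff_eq hd'.ne']
        push_cast
        ring
      rw [Real.log_div hd'.ne' hd.ne'] at h1
      rw [Real.log_div hd.ne' ha.ne'] at ih
      rw [waitSum_succ, mul_add, h2, Real.log_div hd'.ne' ha.ne']
      linarith
  refine (key n).trans (Real.log_le_log (by positivity) ?_)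
  rw [div_le_div_iff₀ (by positivity) hq]
  nlinarith [mul_pos hN hq]

lemma log_sub_le_waitSum (hp0 : 0 < p) (hp1 : p < 1) (hn : 1 ≤ n * (1 - p)) :
    Real.log (1 / (1 - p)) - Real.log 5 ≤ waitSum n p n := by
  have hq : 0 < 1 - p := by linarith
  have hn0 : 0 < n := by
    rcases Nat.eq_zero_or_pos n with h | h
    · subst h
      norm_num at hn
    · exact h
  have hN : (0 : ℝ) < n := by exact_mod_cast hn0
  have ha : 0 ≤ 4 * n * (1 - p) := by positivity
  have key : ∀ k : ℕ, Real.log ((k + 1 + 4 * n * (1 - p)) / (1 + 4 * n * (1 - p))) ≤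
      waitSum n p k := by
    intro k
    induction k with
    | zero =>
      have : 1 + 4 * n * (1 - p) ≠ 0 := by positivity
      simp [waitSum, div_self this]
    | succ k ih =>
      have hd : 0 < (k : ℝ) + 1 + 4 * n * (1 - p) := by positivity
      have hd' : 0 < (k : ℝ) + 1 + 1 + 4 * n * (1 - p) := by positivity
      have ha' : 0 < 1 + 4 * n * (1 - p) := by positivity
      have h1 := Real.log_le_sub_one_of_pos (div_pos hd' hd)
      have h2 : ((k : ℝ) + 1 + 1 + 4 * n * (1 - p)) / (k + 1 + 4 * n * (1 - p)) - 1 =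
          ((k : ℝ) + 1 + 4 * n * (1 - p))⁻¹ := by
        rw [div_sub_one hd.ne', inv_eq_one_div]
        congr 1
        ring
      have h3 : ((k : ℝ) + 1 + 4 * n * (1 - p))⁻¹ ≤ wait n p (k + 1) := by
        rw [wait]
        refine inv_anti₀ (wait_denom_pos hn0 hp0 hp1 _) ?_
        push_cast
        nlinarith [Nat.cast_nonneg (α := ℝ) k]
      rw [Real.log_div hd'.ne' hd.ne'] at h1
      rw [Real.log_div hd.ne' ha'.ne'] at ih
      push_cast
      rw [waitSum_succ, Real.log_div hd'.ne' ha'.ne']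
      linarith
  refine le_trans ?_ (key n)
  rw [← Real.log_div (by positivity) (by norm_num)]
  refine Real.log_le_log (by positivity) ?_
  rw [div_div, div_le_div_iff₀ (by positivity) (by positivity)]
  nlinarith

lemma sum_inv_le_log (n : ℕ) :
    ∑ j ∈ Finset.range n, 1 / ((j : ℝ) + 1) ≤ 1 + Real.log n := by
  have h := harmonic_le_one_add_log n
  simpa [harmonic] using h

lemma upperProfile_start_le (hn : 0 < n) (hp : 1 / 2 < p) (hp1 : p < 1) :
    upperProfile n p n 0 0 ≤ n * (12 * Real.log (1 / (1 - p)) + 8) +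
      (1 / (1 - p) * (1 + Real.log n) + 2) := by
  have hp0 : 0 < p := by linarith
  have hq : 0 < 1 - p := by linarith
  have hN : (0 : ℝ) < n := by exact_mod_cast hn
  have hS := waitSum_nonneg hn hp0 hp1 n
  have hL := waitSum_le_log hn hp0 hp1
  have hsum : 1 / (1 - p) * ∑ j ∈ Finset.range n, 1 / ((j : ℝ) + 1) ≤
      1 / (1 - p) * (1 + Real.log n) := by
    have := sum_inv_le_log n
    gcongr
  have hinv : 1 / p ≤ 2 := by
    rw [div_le_iff₀ hp0]
    linarith
  have hK : killBonus n p = 4 * (1 / p) + 2 * waitSum n p n := by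
    rw [killBonus]
    field_simp
  have hS2 : waitSum n p n ≤ 2 * Real.log (1 / (1 - p)) := by nlinarith
  have hmain : 4 * n * waitSum n p n + killBonus n p * n ≤
      n * (12 * Real.log (1 / (1 - p)) + 8) := by
    rw [hK]
    nlinarith
  rw [upperProfile, if_pos rfl]
  push_cast
  linarith

lemma le_log_of_one_sub_exp_lt {a : ℝ} (hp1 : p < 1) (h : 1 - Real.exp (-a) < p) :
    a ≤ Real.log (1 / (1 - p)) := by
  have hq : 0 < 1 - p := by linarith
  rw [Real.le_log_iff_exp_le (by positivity), le_div_iff₀ hq]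
  calc Real.exp a * (1 - p) ≤ Real.exp a * Real.exp (-a) := by
        gcongr
        linarith
    _ = 1 := by rw [← Real.exp_add, add_neg_cancel, Real.exp_zero]

lemma log_five_le : Real.log 5 ≤ 2 := by
  rw [Real.log_le_iff_le_exp (by norm_num)]
  have h : (2.7 : ℝ) ≤ Real.exp 1 := by linarith [Real.exp_one_gt_d9]
  calc (5 : ℝ) ≤ 2.7 ^ 2 := by norm_num
    _ ≤ Real.exp 1 ^ 2 := by gcongr
    _ = Real.exp 2 := by rw [← Real.exp_nat_mul]; norm_num

lemma expectedTime_of_not_alive {V : Type} [DecidableEq V] [Fintype V] {G : SimpleGraph V}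
    [DecidableRel G.Adj] {p : unitInterval} {x : Config V} (hx : ¬ x.Alive) :
    expectedTime G p x = 0 := by
  classical
  let f : Config V → ENNReal := fun y => if y.Alive then ⊤ else 0
  have hf : ∀ x, ∑' y, step G p x y * f y + aliveInd x ≤ f x := by
    intro x
    by_cases ha : x.Alive
    · simp [f, ha]
    · rw [step_of_not_alive ha, aliveInd_of_not_alive ha, add_zero, tsum_eq_single x]
      · simp
      · intro y hy
        simp [hy]
  refine le_antisymm ((expectedTime_le_of_drift hf x).trans ?_) (zero_le)
  simp [f, hx]

lemma starTime_lt_top (p : unitInterval) (hp0 : 0 < (p : ℝ)) (hp1 : (p : ℝ) < 1) (n : ℕ)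
    {B : Finset (Fin (2 * n))} (hB : B.card = n) : starTime p n B < ⊤ := by
  rcases Nat.eq_zero_or_pos n with rfl | hn
  · have hx : ¬ (starInit B).Alive := by
      have h := starInit_admissible hB
      have hb : Multiset.card (starInit B).blue = 0 := Nat.le_zero.1 h.card_le
      have hr : Multiset.card (starInit B).red = 0 := h.card_eq.trans hb
      exact not_not.2 ⟨Multiset.card_eq_zero.1 hb, Multiset.card_eq_zero.1 hr⟩
    rw [starTime, expectedTime_of_not_alive hx]
    exact ENNReal.zero_lt_top
  · exact (starTime_le p hn hp0 hp1 hB).trans_lt ENNReal.ofReal_lt_top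

/-- The bound `9` covers the loss `4 * log 5 ≤ 8` in the sum of the waiting times and leaves a
slack of at least `n`. -/
theorem liminf_starTime_pos {c : ℝ} (p : unitInterval) (hp0 : 0 < (p : ℝ)) (hp1 : (p : ℝ) < 1)
    (hc : 9 ≤ (4 - c) * Real.log (1 / (1 - (p : ℝ)))) (B : (n : ℕ) → Finset (Fin (2 * n)))
    (hB : ∀ n, (B n).card = n) :
    0 < liminf (fun n : ℕ => (starTime p n (B n) : EReal) -
      ((c * Real.log (1 / (1 - (p : ℝ))) * (n : ℝ) : ℝ) : EReal)) atTop := by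
  have hq : 0 < 1 - (p : ℝ) := by linarith
  refine lt_of_lt_of_le (b := ((1 : ℝ) : EReal)) (by exact_mod_cast zero_lt_one) ?_
  refine le_liminf_of_le (by isBoundedDefault) ?_
  obtain ⟨N, hN⟩ := exists_nat_ge (1 / (1 - (p : ℝ)))
  filter_upwards [eventually_ge_atTop (max N 1)] with n hn
  have hn0 : 0 < n := (le_max_right N 1).trans hn
  have hn1 : (1 : ℝ) ≤ n := by exact_mod_cast hn0
  have hnq : 1 ≤ n * (1 - (p : ℝ)) := by
    rw [← div_le_iff₀ hq]
    exact hN.trans (by exact_mod_cast (le_max_left N 1).trans hn)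
  have hlow := le_starTime p hn0 hp0 hp1 (hB n)
  have hS := log_sub_le_waitSum hp0 hp1 hnq
  have h5 := log_five_le
  set A := 4 * n * waitSum n p n with hA
  set L := Real.log (1 / (1 - (p : ℝ))) with hL
  have hreal : 1 ≤ A - c * L * n := by
    have h1 : (n : ℝ) * (4 * (L - 2)) ≤ A := by
      rw [hA]
      nlinarith
    nlinarith
  have hEA : (A : EReal) ≤ (starTime p n (B n) : EReal) := by
    refine le_trans ?_ (EReal.coe_ennreal_le_coe_ennreal_iff.2 hlow)
    rw [EReal.coe_ennreal_ofReal]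
    exact_mod_cast le_max_left _ _
  calc ((1 : ℝ) : EReal) ≤ ((A - c * L * n : ℝ) : EReal) := by exact_mod_cast hreal
    _ = (A : EReal) - ((c * L * n : ℝ) : EReal) := EReal.coe_sub _ _
    _ ≤ _ := EReal.sub_le_sub hEA le_rfl

/-- The bound `9` covers the linear error `8 * n` of the upper Lyapunov function and leaves a slack
of at least `n` for the logarithmic one. -/
theorem limsup_starTime_lt_top {C : ℝ} (p : unitInterval) (hp : 1 / 2 < (p : ℝ))
    (hp1 : (p : ℝ) < 1) (hC : 9 ≤ (C - 12) * Real.log (1 / (1 - (p : ℝ))))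
    (B : (n : ℕ) → Finset (Fin (2 * n))) (hB : ∀ n, (B n).card = n) :
    limsup (fun n : ℕ => (starTime p n (B n) : EReal) -
      ((C * Real.log (1 / (1 - (p : ℝ))) * (n : ℝ) : ℝ) : EReal)) atTop < ⊤ := by
  have hp0 : 0 < (p : ℝ) := by linarith
  have hq : 0 < 1 - (p : ℝ) := by linarith
  refine lt_of_le_of_lt (b := ((0 : ℝ) : EReal)) ?_ (EReal.coe_lt_top 0)
  refine limsup_le_of_le (by isBoundedDefault) ?_
  -- The logarithmic error is eventually absorbed by the linear slack.
  have hlittle : ∀ᶠ n : ℕ in atTop,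
      1 / (1 - (p : ℝ)) * (1 + Real.log n) + 2 ≤ (n : ℝ) := by
    have h1 : (fun x : ℝ => 1 / (1 - (p : ℝ)) * (1 + Real.log x) + 2) =o[atTop]
        (fun x : ℝ => x) := by
      refine Asymptotics.IsLittleO.add (Asymptotics.IsLittleO.const_mul_left ?_ _) ?_
      · exact (Asymptotics.isLittleO_const_id_atTop 1).add Real.isLittleO_log_id_atTop
      · exact Asymptotics.isLittleO_const_id_atTop 2
    have h2 := (h1.bound zero_lt_one).and (eventually_ge_atTop (0 : ℝ))
    filter_upwards [tendsto_natCast_atTop_atTop.eventually h2] with n hn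
    have h3 := hn.1
    rw [one_mul, Real.norm_of_nonneg hn.2] at h3
    exact (le_abs_self _).trans h3
  filter_upwards [hlittle, eventually_gt_atTop 0] with n hlog hn
  have hN : (0 : ℝ) < n := by exact_mod_cast hn
  have hup := starTime_le p hn hp0 hp1 (hB n)
  have hU := upperProfile_start_le hn hp hp1
  have hU0 : 0 ≤ upperProfile n p n 0 0 :=
    upperProfile_nonneg hn hp0 hp1 (Nat.zero_le n) le_rfl
  set A := upperProfile n p n 0 0 with hA
  set L := Real.log (1 / (1 - (p : ℝ))) with hL
  have hreal : A - C * L * n ≤ 0 := by nlinarith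
  have hEA : (starTime p n (B n) : EReal) ≤ (A : EReal) := by
    refine le_trans (EReal.coe_ennreal_le_coe_ennreal_iff.2 hup) ?_
    rw [EReal.coe_ennreal_ofReal, max_eq_left hU0]
  calc _ ≤ (A : EReal) - ((C * L * n : ℝ) : EReal) := EReal.sub_le_sub hEA le_rfl
    _ = ((A - C * L * n : ℝ) : EReal) := (EReal.coe_sub _ _).symm
    _ ≤ _ := by exact_mod_cast hreal

end Asymptotics

end TwoType

theorem mainTheorem2 :
    (∀ c : ℝ, c < 4 → ∃ pstar : ℝ, 1 / 2 ≤ pstar ∧ pstar < 1 ∧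
      ∀ p : unitInterval, pstar < (p : ℝ) → (p : ℝ) < 1 →
        ∀ B : (n : ℕ) → Finset (Fin (2 * n)), (∀ n, (B n).card = n) →
          (∀ n, TwoType.starTime p n (B n) < ⊤) ∧
          0 < Filter.liminf (fun n : ℕ => (TwoType.starTime p n (B n) : EReal) -
            ((c * Real.log (1 / (1 - (p : ℝ))) * (n : ℝ) : ℝ) : EReal)) Filter.atTop) ∧
    (∀ C : ℝ, 12 < C → ∃ pstar : ℝ, 1 / 2 ≤ pstar ∧ pstar < 1 ∧
      ∀ p : unitInterval, pstar < (p : ℝ) → (p : ℝ) < 1 →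
        ∀ B : (n : ℕ) → Finset (Fin (2 * n)), (∀ n, (B n).card = n) →
          (∀ n, TwoType.starTime p n (B n) < ⊤) ∧
          Filter.limsup (fun n : ℕ => (TwoType.starTime p n (B n) : EReal) -
            ((C * Real.log (1 / (1 - (p : ℝ))) * (n : ℝ) : ℝ) : EReal)) Filter.atTop < ⊤) := by
  have hlt : ∀ a : ℝ, max (1 / 2) (1 - Real.exp (-a)) < 1 := fun a =>
    max_lt (by norm_num) (by linarith [Real.exp_pos (-a)])
  constructor
  · intro c hc
    refine ⟨max (1 / 2) (1 - Real.exp (-(9 / (4 - c)))), le_max_left _ _, hlt _,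
      fun p hp hp1 B hB => ?_⟩
    obtain ⟨hp2, hpe⟩ := max_lt_iff.1 hp
    have hp0 : 0 < (p : ℝ) := by linarith
    have hL := TwoType.le_log_of_one_sub_exp_lt hp1 hpe
    rw [div_le_iff₀ (by linarith), mul_comm] at hL
    exact ⟨fun n => TwoType.starTime_lt_top p hp0 hp1 n (hB n),
      TwoType.liminf_starTime_pos p hp0 hp1 hL B hB⟩
  · intro C hC
    refine ⟨max (1 / 2) (1 - Real.exp (-(9 / (C - 12)))), le_max_left _ _, hlt _,
      fun p hp hp1 B hB => ?_⟩
    obtain ⟨hp2, hpe⟩ := max_lt_iff.1 hp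
    have hp0 : 0 < (p : ℝ) := by linarith
    have hL := TwoType.le_log_of_one_sub_exp_lt hp1 hpe
    rw [div_le_iff₀ (by linarith), mul_comm] at hL
    exact ⟨fun n => TwoType.starTime_lt_top p hp0 hp1 n (hB n),
      TwoType.limsup_starTime_lt_top p hp2 hp1 hL B hB⟩
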